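/- An election $E=(C,V)$ consists of a finite set $C$ of candidates and a finite set $V$ of voters, where every voter $v\in V$ has a ranking (strict linear order) $\succ_v$ of $C$. For $C'\subseteq C$ and $V'\subseteq V$, the subelection $(C',V')$ (the voters of $V'$ with their rankings restricted to $C'$) is an antagonism if $|V'|$ is even and $V'$ can be split into two disjoint sets $V_1,V_2$ with $|V_1|=|V_2|$ such that for all $v_1\in V_1$, $v_2\in V_2$ and all $c,c'\in C'$ we have $c\succ_{v_1}c'$ if and only if $c'\succ_{v_2}c$. The problem Hidden-AN is: given an election $E=(C,V)$ and $m',n'\in\mathbb N$, is there an antagonism subelection $(C',V')$ of $E$ with $|C'|\ge m'$ and $|V'|\ge n'$? **Corollary.** Write $|x|$ for the length of a standard encoding of an instance $x=(E,m',n')$. (1) Hidden-AN is in FPT when parameterized by the number of voters $|V|$, and it is in FPT when parameterized by the number of candidates $|C|$: for each of these two parameters $k$, Hidden-AN can be decided by a (multi-stack) Turing machine in at most $f(k)\cdot|x|^{c}$ steps, for some computable function $f$ and some constant $c$. (2) Hidden-AN is in XP when parameterized by the required number $n'$ of voters in the solution, and it is in XP when parameterized by the required number $m'$ of candidates in the solution: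 for each of these two parameters $k$, Hidden-AN can be decided by a (multi-stack) Turing machine in at most $f(k)\cdot|x|^{g(k)}$ steps, for some computable functions $f$ and $g$. -/

import Mathlib

namespace HiddenSubelections

/-! ### Elections, subelections and antagonism -/

/-- An (ordinal) election. The candidates are named `0, …, numCandidates - 1` and the voters
`0, …, numVoters - 1`. Every voter `v` submits a ranking of all candidates, listed from the most
to the least preferred one: `ranking v i` is the candidate that `v` puts at position `i`. -/
structure Election where
  numCandidates : ℕ
  numVoters : ℕ
  ranking : Fin numVoters → Equiv.Perm (Fin numCandidates)

/-- `E.Prefers v c c'` is `c ≻_v c'`: voter `v` ranks `c` strictly above `c'`. -/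
def Election.Prefers (E : Election) (v : Fin E.numVoters) (c c' : Fin E.numCandidates) : Prop :=
  (E.ranking v).symm c < (E.ranking v).symm c'

/-- The subelection `(C', V')` of `E` (voters in `V'`, with their preferences restricted to `C'`)
is an antagonism: `|V'|` is even, and `V'` splits into two disjoint parts of equal size such that
any two voters from different parts rank every pair of candidates of `C'` in opposite ways. -/
def Election.IsAntagonism (E : Election) (C' : Finset (Fin E.numCandidates))
    (V' : Finset (Fin E.numVoters)) : Prop :=
  Even V'.card ∧
    ∃ V₁ V₂ : Finset (Fin E.numVoters),
      V₁ ∪ V₂ = V' ∧ Disjoint V₁ V₂ ∧ V₁.card = V₂.card ∧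
        ∀ v₁ ∈ V₁, ∀ v₂ ∈ V₂, ∀ c ∈ C', ∀ c' ∈ C', E.Prefers v₁ c c' ↔ E.Prefers v₂ c' c

/-- An instance `(E, m', n')` of the problem Hidden-AN. -/
structure Instance where
  election : Election
  /-- the required number `m'` of candidates in the solution -/
  solCandidates : ℕ
  /-- the required number `n'` of voters in the solution -/
  solVoters : ℕ

/-- The problem Hidden-AN: is there an antagonism subelection `(C', V')` with `|C'| ≥ m'` and
`|V'| ≥ n'`? -/
def HiddenAN (I : Instance) : Prop :=
  ∃ (C' : Finset (Fin I.election.numCandidates)) (V' : Finset (Fin I.election.numVoters)),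
    I.election.IsAntagonism C' V' ∧ I.solCandidates ≤ C'.card ∧ I.solVoters ≤ V'.card

/-! ### Encoding of instances -/

/-- The input alphabet: binary digits and two separators. -/
inductive InputSymbol where
  | bit (b : Bool)
  | comma
  | semi
  deriving DecidableEq, Fintype

/-- A natural number in binary (least significant digit first), terminated by a comma. -/
def encodeNumber (k : ℕ) : List InputSymbol :=
  (Computability.encodeNat k).map InputSymbol.bit ++ [InputSymbol.comma]

/-- A list of natural numbers, terminated by a semicolon. -/
def encodeNumbers (l : List ℕ) : List InputSymbol :=
  l.flatMap encodeNumber ++ [InputSymbol.semi]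

/-- The vote of `v`: its candidates from the most to the least preferred one. -/
def Election.voteList (E : Election) (v : Fin E.numVoters) : List ℕ :=
  (List.finRange E.numCandidates).map fun i => (E.ranking v i : ℕ)

/-- The encoding of `(E, m', n')`: the numbers `m'` and `n'` in binary, the list of the candidates,
and the list of the votes. -/
def Instance.encode (I : Instance) : List InputSymbol :=
  encodeNumber I.solCandidates ++ encodeNumber I.solVoters ++
    encodeNumbers (List.range I.election.numCandidates) ++
    (List.finRange I.election.numVoters).flatMap fun v => encodeNumbers (I.election.voteList v)

theorem encodeNumber_append_inj {a b : ℕ} {r s : List InputSymbol}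
    (h : encodeNumber a ++ r = encodeNumber b ++ s) : a = b ∧ r = s := by
  have key : ∀ l l' : List Bool, ∀ r s : List InputSymbol,
      l.map InputSymbol.bit ++ InputSymbol.comma :: r = l'.map InputSymbol.bit ++ InputSymbol.comma :: s → l = l' ∧ r = s := by
    intro l
    induction l with
    | nil => intro l' r s h; cases l' <;> simp_all
    | cons x l ih =>
      intro l' r s h
      cases l' with
      | nil => simp at h
      | cons y l' =>
        simp only [List.map_cons, List.cons_append, List.cons.injEq, InputSymbol.bit.injEq] at h
        obtain ⟨h1, h2⟩ := ih l' r s h.2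
        exact ⟨by rw [h.1, h1], h2⟩
  simp only [encodeNumber, List.append_assoc, List.singleton_append] at h
  obtain ⟨h1, h2⟩ := key _ _ _ _ h
  refine ⟨?_, h2⟩
  rw [← Computability.decode_encodeNat a, h1, Computability.decode_encodeNat]

theorem encodeNumbers_append_inj {l l' : List ℕ} {r s : List InputSymbol}
    (h : encodeNumbers l ++ r = encodeNumbers l' ++ s) : l = l' ∧ r = s := by
  have hne : ∀ (a : ℕ) (t u : List InputSymbol), encodeNumber a ++ t ≠ InputSymbol.semi :: u := by
    intro a t u h
    unfold encodeNumber at h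
    cases hc : Computability.encodeNat a <;> simp [hc] at h
  induction l generalizing l' with
  | nil =>
    cases l' with
    | nil => simpa [encodeNumbers] using h
    | cons b l' =>
      simp only [encodeNumbers, List.flatMap_cons, List.flatMap_nil, List.append_assoc,
        List.nil_append, List.singleton_append] at h
      exact absurd h.symm (hne _ _ _)
  | cons a l ih =>
    cases l' with
    | nil =>
      simp only [encodeNumbers, List.flatMap_cons, List.flatMap_nil, List.append_assoc,
        List.nil_append, List.singleton_append] at h
      exact absurd h (hne _ _ _)
    | cons b l' =>
      simp only [encodeNumbers, List.flatMap_cons, List.append_assoc] at h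
      obtain ⟨h1, h2⟩ := encodeNumber_append_inj h
      obtain ⟨h3, h4⟩ := ih (l' := l') (by simpa [encodeNumbers] using h2)
      exact ⟨by rw [h1, h3], h4⟩

/-- Different instances have different encodings. -/
theorem Instance.encode_injective : Function.Injective Instance.encode := by
  have key : ∀ L L' : List (List ℕ), L.flatMap encodeNumbers = L'.flatMap encodeNumbers →
      L = L' := by
    intro L
    induction L with
    | nil => intro L' h; cases L' <;> simp_all [encodeNumbers]
    | cons x L ih =>
      intro L' h
      cases L' with
      | nil => simp [encodeNumbers] at h
      | cons y L' =>
        simp only [List.flatMap_cons] at h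
        obtain ⟨h1, h2⟩ := encodeNumbers_append_inj h
        rw [h1, ih _ h2]
  rintro ⟨⟨m, n, R⟩, p, q⟩ ⟨⟨m', n', R'⟩, p', q'⟩ h
  simp only [Instance.encode, List.append_assoc] at h
  obtain ⟨hp, h₁⟩ := encodeNumber_append_inj h
  obtain ⟨hq, h₂⟩ := encodeNumber_append_inj h₁
  obtain ⟨h₀, h₃⟩ := encodeNumbers_append_inj h₂
  clear h h₁ h₂
  subst hp hq
  obtain rfl : m = m' := by simpa using congrArg List.length h₀
  have h := key ((List.finRange n).map (Election.voteList ⟨m, n, R⟩))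
    ((List.finRange n').map (Election.voteList ⟨m, n', R'⟩)) (by simpa [List.flatMap_map] using h₃)
  obtain rfl : n = n' := by simpa using congrArg List.length h
  have hR : R = R' := by
    funext v
    have hv : Election.voteList ⟨m, n, R⟩ v = Election.voteList ⟨m, n, R'⟩ v :=
      List.map_inj_left.mp h v (List.mem_finRange v)
    ext i
    exact List.map_inj_left.mp hv i (List.mem_finRange i)
  subst hR
  rfl

/-! ### Time-bounded decidability, FPT and XP

The machine model is Mathlib's multi-stack Turing machine `Turing.FinTM2`. -/

/-- The problem `P` on `α`, with inputs presented through `enc`, is decided by a (deterministic)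
Turing machine that takes at most `T a` steps on every input `a`. -/
def DecidableInTime {α Γ : Type} (enc : α → List Γ) (P : α → Prop) (T : α → ℕ) : Prop :=
  ∃ M : Turing.TM2ComputableAux Γ Bool,
    (∀ k, Finite (M.tm.Γ k)) ∧
      ∀ a : α, ∃ b : Bool, (b = true ↔ P a) ∧
        Nonempty (Turing.TM2OutputsInTime M.tm
          ((enc a).map M.inputAlphabet.invFun)
          (some ((Computability.encodeBool b).map M.outputAlphabet.invFun))
          (T a))

/-- `P`, parameterized by `κ`, is fixed-parameter tractable: it is decided in time
`f(k) · |x| ^ c`, where `k` is the parameter and `|x|` the length of the input, for a computable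
function `f` and a constant `c`. -/
def IsFPT {α Γ : Type} (enc : α → List Γ) (P : α → Prop) (κ : α → ℕ) : Prop :=
  ∃ (f : ℕ → ℕ) (c : ℕ), Computable f ∧
    DecidableInTime enc P fun a => f (κ a) * (enc a).length ^ c

/-- `P`, parameterized by `κ`, is in XP: it is decided in time `f(k) · |x| ^ g(k)`, where `k` is
the parameter and `|x|` the length of the input, for computable functions `f` and `g`. -/
def IsXP {α Γ : Type} (enc : α → List Γ) (P : α → Prop) (κ : α → ℕ) : Prop :=
  ∃ f g : ℕ → ℕ, Computable f ∧ Computable g ∧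
    DecidableInTime enc P fun a => f (κ a) * (enc a).length ^ g (κ a)

end HiddenSubelections

/-! Let `h = ⌈n'/2⌉`. Deleting candidates, or equally many voters from both sides, keeps an
antagonism, so a solution may be taken with exactly `m'` candidates and `h` voters on each side
(`hiddenAN_iff`). If `h > 0`, all voters of one side agree on `C'`, because each is opposite to a
common voter of the other side. A solution is then a list `s` of `m'` candidates, `h` voters who
rank along `s`, and `h` other voters who rank against it (`hiddenAN_iff_sorts`). Either ingredient
can be guessed and the other found in polynomial time.

Guessing candidates: for every `m'`-tuple `s`, let `A` and `B` be the sets of voters ranking along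
and against `s`. Disjoint `h`-subsets exist iff `|A| ≥ h`, `|B| ≥ h` and `|A ∪ B| ≥ 2h`
(`exists_disjoint_subsets_iff`, `searchCandidates_iff`).

Guessing voters: for two `h`-tuples of distinct voters, "the first side prefers `c` to `d` and the
second `d` to `c`" is a transitive relation. A list `s` of length `m'` is a chain in it, and chains
are found level by level (`hasChain_iff`, `searchVoters_iff`).

With `N` objects and tuples of length `k`, the time is polynomial in `|x| + N ^ k`. Both searches
answer at once when there are too few objects, so `k ≤ N`, and `N ^ k` is bounded by `N ^ N` for
FPT; `N ≤ |x|`, with `k` at most the required number, gives XP.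

For the machine model, flowcharts over six stacks are compiled to `FinTM2`, and binary trees in
prefix notation serve as data. The class `Bdd μ` of functions computed in time polynomial in a
measure `μ` is closed under composition, pairing, branching and folds with bounded accumulators.
Taking `μ = |x| + N ^ k` covers the searches. -/

namespace HiddenSubelections

open Function

/-! ### Flowcharts over stacks -/

/-- The stacks of the machines: the input stack, the output stack, the main stack `e` and three
auxiliary stacks. -/
inductive Stk where
  | inp | out | e | w | z | y
  deriving DecidableEq

instance : Fintype Stk :=
  ⟨{.inp, .out, .e, .w, .z, .y}, fun k => by cases k <;> simp⟩

/-- The stack alphabets. -/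
@[reducible] def Stk.Sym : Stk → Type
  | .inp => InputSymbol
  | _ => Bool

instance (k : Stk) : Fintype k.Sym := by cases k <;> exact inferInstance

/-- The contents of all stacks. -/
abbrev Store := ∀ k : Stk, List k.Sym

/-- The instructions of a flowchart with set of labels `Λ`; the target `none` is the exit. -/
inductive Instr (Λ : Type) where
  | push (k : Stk) (a : k.Sym) (next : Option Λ)
  | pop (k : Stk) (next : Option k.Sym → Option Λ)

/-- The effect of an instruction. -/
def Instr.exec {Λ : Type} : Instr Λ → Store → Option Λ × Store
  | .push k a next, s => (next, update s k (a :: s k))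
  | .pop k next, s => (next (s k).head?, update s k (s k).tail)

/-- Redirect the jumps of an instruction. -/
def Instr.map {Λ Λ' : Type} (φ : Option Λ → Option Λ') : Instr Λ → Instr Λ'
  | .push k a next => .push k a (φ next)
  | .pop k next => .pop k fun a => φ (next a)

theorem Instr.exec_map {Λ Λ' : Type} (φ : Option Λ → Option Λ') (i : Instr Λ) (s : Store) :
    (i.map φ).exec s = (φ (i.exec s).1, (i.exec s).2) := by
  cases i <;> rfl

/-- `Runs M n c c'`: the flowchart `M` goes from `c` to `c'` in exactly `n` steps. -/
inductive Runs {Λ : Type} (M : Λ → Instr Λ) : ℕ → Option Λ × Store → Option Λ × Store → Prop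
  | refl (c) : Runs M 0 c c
  | step {n l s c'} : Runs M n ((M l).exec s) c' → Runs M (n + 1) (some l, s) c'

theorem Runs.trans {Λ : Type} {M : Λ → Instr Λ} {n m : ℕ} {a b c} (h : Runs M n a b)
    (h' : Runs M m b c) : Runs M (n + m) a c := by
  induction h with
  | refl => simpa using h'
  | step _ ih => rw [Nat.add_right_comm]; exact .step (ih h')

/-- Combinators contain copies of their parts. If `g` carries the instructions of `M` to `M'`, with
the exit redirected to `x`, runs carry over step by step without a change of length. -/
theorem Runs.relabel {Λ Λ' : Type} {M : Λ → Instr Λ} {M' : Λ' → Instr Λ'}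
    (g : Λ → Λ') (x : Option Λ')
    (hM : ∀ l, M' (g l) = (M l).map fun o => o.elim x fun l => some (g l)) {n : ℕ} {a b}
    (h : Runs M n a b) :
    Runs M' n (a.1.elim x fun l => some (g l), a.2) (b.1.elim x fun l => some (g l), b.2) := by
  induction h with
  | refl => exact .refl _
  | step _ ih =>
    refine .step ?_
    rw [hM, Instr.exec_map]
    exact ih

/-- A flowchart with finitely many labels and an entry point. -/
structure Frag where
  Λ : Type
  fin : Fintype Λ
  entry : Option Λ
  instr : Λ → Instr Λ

attribute [instance] Frag.fin

/-- Started with the stacks `s`, the flowchart `P` exits with the stacks `s'` after at most `n`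
steps. -/
def Frag.Does (P : Frag) (s s' : Store) (n : ℕ) : Prop :=
  ∃ m ≤ n, Runs P.instr m (P.entry, s) (none, s')

theorem Frag.Does.mono {P : Frag} {s s' : Store} {n m : ℕ} (h : P.Does s s' n) (hn : n ≤ m) :
    P.Does s s' m :=
  let ⟨k, hk, h⟩ := h; ⟨k, hk.trans hn, h⟩

/-- The stacks with the given contents. -/
def store (i : List InputSymbol) (o e w z y : List Bool) : Store
  | .inp => i
  | .out => o
  | .e => e
  | .w => w
  | .z => z
  | .y => y

namespace Frag

/-- Do nothing. -/
def skip : Frag := ⟨Empty, inferInstance, none, Empty.elim⟩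

theorem does_skip (s : Store) (n : ℕ) : skip.Does s s n := ⟨0, Nat.zero_le _, .refl _⟩

/-- Push `a` on the stack `k`. -/
def push (k : Stk) (a : k.Sym) : Frag := ⟨Unit, inferInstance, some (), fun _ => .push k a none⟩

theorem does_push (k : Stk) (a : k.Sym) (s : Store) :
    (push k a).Does s (update s k (a :: s k)) 1 :=
  ⟨1, le_rfl, .step (.refl _)⟩

/-- First `P`, then `Q`. -/
def seq (P Q : Frag) : Frag where
  Λ := P.Λ ⊕ Q.Λ
  fin := inferInstance
  entry := P.entry.elim (Q.entry.elim none fun l => some (.inr l)) fun l => some (.inl l)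
  instr
    | .inl l => (P.instr l).map fun o =>
        o.elim (Q.entry.elim none fun l => some (.inr l)) fun l => some (.inl l)
    | .inr l => (Q.instr l).map fun o => o.elim none fun l => some (.inr l)

theorem Does.seq {P Q : Frag} {s s' s'' : Store} {n m : ℕ} (hP : P.Does s s' n)
    (hQ : Q.Does s' s'' m) : (P.seq Q).Does s s'' (n + m) := by
  obtain ⟨a, ha, hP⟩ := hP
  obtain ⟨b, hb, hQ⟩ := hQ
  refine ⟨a + b, by omega, ?_⟩
  have h1 := hP.relabel (M' := (P.seq Q).instr) .inl
    (Q.entry.elim none fun l => some (.inr l)) fun l => rfl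
  have h2 := hQ.relabel (M' := (P.seq Q).instr) .inr none fun l => rfl
  refine h1.trans ?_
  exact h2

/-- Pop a symbol from the stack `k` and continue accordingly. -/
def popCase (k : Stk) (f : Option k.Sym → Frag) : Frag where
  Λ := Option (Σ a, (f a).Λ)
  fin := inferInstance
  entry := some none
  instr
    | none => .pop k fun a => (f a).entry.elim none fun l => some (some ⟨a, l⟩)
    | some ⟨a, l⟩ => ((f a).instr l).map fun o => o.elim none fun l => some (some ⟨a, l⟩)

theorem does_popCase {k : Stk} {f : Option k.Sym → Frag} {s s' : Store} {n : ℕ}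
    (h : (f (s k).head?).Does (update s k (s k).tail) s' n) :
    (popCase k f).Does s s' (n + 1) := by
  obtain ⟨a, ha, h⟩ := h
  refine ⟨a + 1, by omega, .step ?_⟩
  have h1 := h.relabel (M' := (popCase k f).instr)
    (fun l => some ⟨(s k).head?, l⟩) none fun l => rfl
  exact h1

/-- While the stack `k` is nonempty, pop a symbol and run the body. -/
def whilePop (k : Stk) (f : k.Sym → Frag) : Frag where
  Λ := Option (Σ a, (f a).Λ)
  fin := inferInstance
  entry := some none
  instr
    | none => .pop k fun o => o.elim none fun a =>
        (f a).entry.elim (some none) fun l => some (some ⟨a, l⟩)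
    | some ⟨a, l⟩ => ((f a).instr l).map fun o => o.elim (some none) fun l => some (some ⟨a, l⟩)

theorem does_whilePop_nil {k : Stk} {f : k.Sym → Frag} {s : Store} (h : s k = []) :
    (whilePop k f).Does s s 1 := by
  refine ⟨1, le_rfl, .step ?_⟩
  have : (whilePop k f).instr none = .pop k fun o => o.elim none fun a =>
    (f a).entry.elim (some none) fun l => some (some ⟨a, l⟩) := rfl
  rw [this]
  have h2 : update s k (s k).tail = s := by
    rw [update_eq_self_iff, h, List.tail_nil]
  simp only [Instr.exec, h2]
  rw [h]
  exact .refl _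

theorem does_whilePop_cons {k : Stk} {f : k.Sym → Frag} {s s' s'' : Store} {a : k.Sym}
    {r : List k.Sym} {n m : ℕ} (hs : s k = a :: r) (h : (f a).Does (update s k r) s' n)
    (h' : (whilePop k f).Does s' s'' m) : (whilePop k f).Does s s'' (m + n + 1) := by
  obtain ⟨i, hi, h⟩ := h
  obtain ⟨j, hj, h'⟩ := h'
  refine ⟨(i + j) + 1, by omega, .step ?_⟩
  have : (whilePop k f).instr none = .pop k fun o => o.elim none fun a =>
    (f a).entry.elim (some none) fun l => some (some ⟨a, l⟩) := rfl
  rw [this]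
  simp only [Instr.exec, hs, List.head?_cons, List.tail_cons, Option.elim_some]
  exact (h.relabel (M' := (whilePop k f).instr) (fun l => some ⟨a, l⟩) (some none)
    fun l => rfl).trans h'

/-! ### Flowcharts as Turing machines -/

/-- The memory of the machine: the last symbol that was popped. -/
abbrev Mem := Option (Σ k : Stk, Option k.Sym)

/-- The statement of an instruction. -/
def _root_.HiddenSubelections.Instr.toStmt {Λ : Type} :
    Instr Λ → Turing.TM2.Stmt Stk.Sym (Option Λ) Mem
  | .push k a next => .push k (fun _ => a) (.goto fun _ => next)
  | .pop k next => .pop k (fun _ a => some ⟨k, a⟩)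
      -- A jump sees only the memory, so the popped symbol is stored there with its stack as a tag.
      -- The jump directly follows the pop, hence the fallback branches are never taken.
      (.goto fun v => match v with
        | none => none
        | some ⟨k', a⟩ => if h : k' = k then next (h ▸ a) else none)

/-- The Turing machine of a flowchart. -/
def toTM (P : Frag) : Turing.FinTM2 where
  K := Stk
  k₀ := .inp
  k₁ := .out
  Γ := Stk.Sym
  Λ := Option P.Λ
  main := P.entry
  σ := Mem
  initialState := none
  Γk₀Fin := inferInstanceAs (Fintype InputSymbol)
  m
    -- The memory is reset because the prescribed halting configuration carries the initial memory.
    | none => .load (fun _ => none) .halt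
    | some l => (P.instr l).toStmt

theorem toTM_step (P : Frag) (l : P.Λ) (v : Mem) (s : Store) :
    ∃ v' : Mem, P.toTM.step ⟨some (some l), v, s⟩ =
      some ⟨some ((P.instr l).exec s).1, v', ((P.instr l).exec s).2⟩ := by
  show ∃ v' : Mem, some (Turing.TM2.stepAux (P.instr l).toStmt v s) = _
  cases P.instr l with
  | push k a next => exact ⟨v, rfl⟩
  | pop k next =>
    refine ⟨some ⟨k, (s k).head?⟩, ?_⟩
    simp only [Instr.toStmt, Turing.TM2.stepAux, Instr.exec, dite_true]
    rfl

theorem toTM_runs {P : Frag} {n : ℕ} {c c'} (h : Runs P.instr n c c') (v : Mem) :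
    ∃ v' : Mem, (flip bind P.toTM.step)^[n] (some ⟨some c.1, v, c.2⟩) =
      some ⟨some c'.1, v', c'.2⟩ := by
  induction h generalizing v with
  | refl => exact ⟨v, rfl⟩
  | @step n l s c' h ih =>
    obtain ⟨v₁, h₁⟩ := P.toTM_step l v s
    obtain ⟨v', h'⟩ := ih v₁
    refine ⟨v', ?_⟩
    rw [iterate_succ_apply, ← h']
    exact congrArg _ h₁

/-- The step added to `T` is the halt at the exit label. Every stack except the output has to end
empty, as the halting configuration prescribes. -/
theorem decidableInTime {α : Type} {enc : α → List InputSymbol} {p : α → Prop} {T : α → ℕ}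
    (P : Frag) (b : α → Bool) (hb : ∀ a, b a = true ↔ p a)
    (h : ∀ a, P.Does (store (enc a) [] [] [] [] []) (store [] [b a] [] [] [] []) (T a)) :
    DecidableInTime enc p fun a => T a + 1 := by
  refine ⟨⟨P.toTM, Equiv.refl _, Equiv.refl _⟩, fun (k : Stk) => Finite.of_fintype k.Sym,
    fun a => ⟨b a, hb a, ?_⟩⟩
  · obtain ⟨n, hn, hr⟩ := h a
    obtain ⟨v, hv⟩ := toTM_runs hr none
    refine ⟨⟨⟨n + 1, ?_⟩, Nat.succ_le_succ hn⟩⟩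
    have hi : Turing.initList P.toTM ((enc a).map (Equiv.refl InputSymbol).invFun) =
        ⟨some P.entry, none, store (enc a) [] [] [] [] []⟩ := by
      have hm : (enc a).map (Equiv.refl InputSymbol).invFun = enc a := List.map_id _
      unfold Turing.initList
      congr 1
      funext k
      cases k <;> first | exact hm | rfl
    have ho : Turing.haltList P.toTM
        ((Computability.encodeBool (b a)).map (Equiv.refl Bool).invFun) =
        ⟨none, none, store [] [b a] [] [] [] []⟩ := by
      unfold Turing.haltList
      congr 1
      funext k
      cases k <;> rfl
    show (flip bind P.toTM.step)^[n + 1] (some (Turing.initList P.toTM _)) =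
      some (Turing.haltList P.toTM _)
    erw [hi, ho, iterate_succ_apply', hv]
    rfl

end Frag

@[simp] theorem update_store_inp (i o e w z y l) :
    update (store i o e w z y) .inp l = store l o e w z y := by
  funext k; cases k <;> rfl

@[simp] theorem update_store_out (i o e w z y l) :
    update (store i o e w z y) .out l = store i l e w z y := by
  funext k; cases k <;> rfl

@[simp] theorem update_store_e (i o e w z y l) :
    update (store i o e w z y) .e l = store i o l w z y := by
  funext k; cases k <;> rfl

@[simp] theorem update_store_w (i o e w z y l) :
    update (store i o e w z y) .w l = store i o e l z y := by
  funext k; cases k <;> rfl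

@[simp] theorem update_store_z (i o e w z y l) :
    update (store i o e w z y) .z l = store i o e w l y := by
  funext k; cases k <;> rfl

@[simp] theorem update_store_y (i o e w z y l) :
    update (store i o e w z y) .y l = store i o e w z l := by
  funext k; cases k <;> rfl

/-! ### Binary trees on the main stack -/

/-- Binary trees, the data of the machines. -/
inductive SExp where
  | nil
  | cons (a b : SExp)

namespace SExp

/-- The number of nodes of a tree. -/
def size : SExp → ℕ
  | nil => 1
  | cons a b => a.size + b.size + 1

/-- The prefix notation of a tree. -/
def ser : SExp → List Bool
  | nil => [false]
  | cons a b => true :: (a.ser ++ b.ser)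

@[simp] theorem length_ser (t : SExp) : t.ser.length = t.size := by
  induction t with
  | nil => rfl
  | cons a b iha ihb => simp [ser, size, iha, ihb]

end SExp

open SExp

namespace Frag

theorem does_push_e (c : Bool) (i o e w z y) :
    (push .e c).Does (store i o e w z y) (store i o (c :: e) w z y) 1 := by
  simpa [store] using does_push .e c (store i o e w z y)

theorem does_push_w (c : Bool) (i o e w z y) :
    (push .w c).Does (store i o e w z y) (store i o e (c :: w) z y) 1 := by
  simpa [store] using does_push .w c (store i o e w z y)

theorem does_push_z (c : Bool) (i o e w z y) :
    (push .z c).Does (store i o e w z y) (store i o e w (c :: z) y) 1 := by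
  simpa [store] using does_push .z c (store i o e w z y)

theorem does_push_y (c : Bool) (i o e w z y) :
    (push .y c).Does (store i o e w z y) (store i o e w z (c :: y)) 1 := by
  simpa [store] using does_push .y c (store i o e w z y)

theorem does_push_out (c : Bool) (i o e w z y) :
    (push .out c).Does (store i o e w z y) (store i (c :: o) e w z y) 1 := by
  simpa [store] using does_push .out c (store i o e w z y)

theorem does_popCase_e {f : Option Bool → Frag} {c : Bool} {i o e w z y s n}
    (h : (f (some c)).Does (store i o e w z y) s n) :
    (popCase .e f).Does (store i o (c :: e) w z y) s (n + 1) :=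
  does_popCase (k := .e) (by simpa [store] using h)

/-- Move the contents of the stack `w` to the stack `e`. -/
def drainWE : Frag := whilePop .w fun c => push .e c

/-- Move the contents of the stack `z` to the stack `e`. -/
def drainZE : Frag := whilePop .z fun c => push .e c

/-- Move the contents of the stack `z` to the stack `w`. -/
def drainZW : Frag := whilePop .z fun c => push .w c

/-- Move the contents of the stack `w` to the stacks `e` and `z`. -/
def drainWEZ : Frag := whilePop .w fun c => seq (push .e c) (push .z c)

theorem does_drainWE (i o e w z y) :
    drainWE.Does (store i o e w z y) (store i o (w.reverse ++ e) [] z y) (2 * w.length + 1) := by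
  induction w generalizing e with
  | nil => exact does_whilePop_nil rfl
  | cons c w ih =>
    refine (does_whilePop_cons (k := .w) (a := c) (r := w) rfl (s' := store i o (c :: e) w z y)
      (n := 1) ?_ (by simpa [drainWE] using ih (c :: e))).mono (by simp; omega)
    rw [update_store_w]
    exact does_push_e _ _ _ _ _ _ _

theorem does_drainZE (i o e w z y) :
    drainZE.Does (store i o e w z y) (store i o (z.reverse ++ e) w [] y) (2 * z.length + 1) := by
  induction z generalizing e with
  | nil => exact does_whilePop_nil rfl
  | cons c z ih =>
    refine (does_whilePop_cons (k := .z) (a := c) (r := z) rfl (s' := store i o (c :: e) w z y)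
      (n := 1) ?_ (by simpa [drainZE] using ih (c :: e))).mono (by simp; omega)
    rw [update_store_z]
    exact does_push_e _ _ _ _ _ _ _

theorem does_drainZW (i o e w z y) :
    drainZW.Does (store i o e w z y) (store i o e (z.reverse ++ w) [] y) (2 * z.length + 1) := by
  induction z generalizing w with
  | nil => exact does_whilePop_nil rfl
  | cons c z ih =>
    refine (does_whilePop_cons (k := .z) (a := c) (r := z) rfl (s' := store i o e (c :: w) z y)
      (n := 1) ?_ (by simpa [drainZW] using ih (c :: w))).mono (by simp; omega)
    rw [update_store_z]
    exact does_push_w _ _ _ _ _ _ _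

theorem does_drainWEZ (i o e w z y) :
    drainWEZ.Does (store i o e w z y) (store i o (w.reverse ++ e) [] (w.reverse ++ z) y)
      (3 * w.length + 1) := by
  induction w generalizing e z with
  | nil => exact does_whilePop_nil rfl
  | cons c w ih =>
    refine (does_whilePop_cons (k := .w) (a := c) (r := w) rfl
      (s' := store i o (c :: e) w (c :: z) y)
      (n := 2) ?_ (by simpa [drainWEZ] using ih (c :: e) (c :: z))).mono (by simp; omega)
    rw [update_store_w]
    exact (does_push_e _ _ _ _ _ _ _).seq (does_push_z _ _ _ _ _ _ _)

/-- Consume the topmost tree of the stack `e`, running `f` on every token. -/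
def scan (f : Bool → Frag) : Frag :=
  seq (push .y true) <| whilePop .y fun _ => popCase .e fun
    | some true => seq (f true) (seq (push .y true) (push .y true))
    | some false => f false
    | none => skip

/-- Prefix notation delimits itself: `y` counts in unary the trees still to be read. A token `true`
replaces one pending tree by two, a token `false` completes one. The worst token costs five steps.
-/
theorem does_scan {f : Bool → Frag} {g h : Bool → List Bool → List Bool} {i o}
    (hf : ∀ c e w z y, (f c).Does (store i o e w z y) (store i o e (g c w) (h c z) y) 1)
    (t : SExp) (e w z : List Bool) :
    (scan f).Does (store i o (t.ser ++ e) w z [])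
      (store i o e (t.ser.foldl (fun l c => g c l) w) (t.ser.foldl (fun l c => h c l) z) [])
      (5 * t.size + 2) := by
  set loop : Frag := whilePop .y fun _ => popCase .e fun
    | some true => seq (f true) (seq (push .y true) (push .y true))
    | some false => f false
    | none => skip with hloop
  -- Continuation form: a run from the state after `t` extends to one from the state before it, so
  -- the induction can treat two subtrees in succession.
  have key : ∀ (t : SExp) (e w z y : List Bool) (s : Store) (n : ℕ),
      loop.Does (store i o e (t.ser.foldl (fun l c => g c l) w)
        (t.ser.foldl (fun l c => h c l) z) y) s n →
      loop.Does (store i o (t.ser ++ e) w z (true :: y)) s (n + 5 * t.size) := by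
    intro t
    induction t with
    | nil =>
      intro e w z y s n hs
      refine (does_whilePop_cons (k := .y) (a := true) (r := y) rfl (n := 2)
        (s' := store i o e (g false w) (h false z) y) ?_ hs).mono (by simp [size])
      rw [update_store_y]
      exact does_popCase_e (hf false e w z y)
    | cons a b iha ihb =>
      intro e w z y s n hs
      refine (does_whilePop_cons (k := .y) (a := true) (r := y) rfl (n := 4)
        (s' := store i o (a.ser ++ (b.ser ++ e)) (g true w) (h true z) (true :: true :: y)) ?_
        (m := n + 5 * b.size + 5 * a.size) ?_).mono (by simp [size]; omega)
      · rw [update_store_y]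
        simp only [ser, List.cons_append, List.append_assoc]
        exact does_popCase_e ((hf true _ w z y).seq
          ((does_push_y _ _ _ _ _ _ _).seq (does_push_y _ _ _ _ _ _ _)))
      · refine iha _ _ _ _ _ _ (ihb _ _ _ _ _ _ ?_)
        simpa [ser] using hs
  refine ((does_push_y _ _ _ _ _ _ _).seq (key t e w z [] _ 1 (does_whilePop_nil rfl))).mono
    (by omega)

/-- Delete the topmost tree. -/
def drop : Frag := scan fun _ => skip

theorem does_drop (t : SExp) (i o e w z) :
    drop.Does (store i o (t.ser ++ e) w z []) (store i o e w z []) (5 * t.size + 2) := by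
  simpa [drop] using does_scan (f := fun _ => skip) (g := fun _ l => l)
    (h := fun _ l => l) (fun _ _ _ _ _ => does_skip _ _) t e w z

/-- Move the topmost tree to the stack `w`. -/
def moveW : Frag := scan fun c => push .w c

theorem does_moveW (t : SExp) (i o e w z) :
    moveW.Does (store i o (t.ser ++ e) w z []) (store i o e (t.ser.reverse ++ w) z [])
      (5 * t.size + 2) := by
  simpa [moveW] using does_scan (f := fun c => push .w c)
    (g := fun c l => c :: l) (h := fun _ l => l)
    (fun _ _ _ _ _ => does_push_w _ _ _ _ _ _ _) t e w z

/-- Move the topmost tree to the stack `z`. -/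
def moveZ : Frag := scan fun c => push .z c

theorem does_moveZ (t : SExp) (i o e w z) :
    moveZ.Does (store i o (t.ser ++ e) w z []) (store i o e w (t.ser.reverse ++ z) [])
      (5 * t.size + 2) := by
  simpa [moveZ] using does_scan (f := fun c => push .z c)
    (g := fun _ l => l) (h := fun c l => c :: l)
    (fun _ _ _ _ _ => does_push_z _ _ _ _ _ _ _) t e w z

/-- Duplicate the topmost tree. -/
def dup : Frag := seq moveW (seq drainWEZ (seq drainZW drainWE))

/-- Every pour reverses. After the pour from `w` one copy is back on `e`, while the copy on `z` has
the orientation of `e` and must pass through `w` to keep it. -/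
theorem does_dup (t : SExp) (i o e) :
    dup.Does (store i o (t.ser ++ e) [] [] []) (store i o (t.ser ++ (t.ser ++ e)) [] [] [])
      (12 * t.size + 5) := by
  have h1 := does_moveW t i o e [] []
  have h2 := does_drainWEZ i o e (t.ser.reverse ++ []) [] []
  have h3 := does_drainZW i o (t.ser ++ e) [] t.ser []
  have h4 := does_drainWE i o (t.ser ++ e) (t.ser.reverse) [] []
  simp only [List.append_nil, List.reverse_reverse, List.length_reverse, length_ser] at h1 h2 h3 h4
  exact (h1.seq (h2.seq (h3.seq h4))).mono (by omega)

/-- Exchange the two topmost trees. -/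
def swap : Frag := seq moveW (seq moveZ (seq drainWE drainZE))

theorem does_swap (s t : SExp) (i o e) :
    swap.Does (store i o (s.ser ++ (t.ser ++ e)) [] [] [])
      (store i o (t.ser ++ (s.ser ++ e)) [] [] []) (7 * (s.size + t.size) + 6) := by
  have h1 := does_moveW s i o (t.ser ++ e) [] []
  have h2 := does_moveZ t i o e s.ser.reverse []
  have h3 := does_drainWE i o e s.ser.reverse t.ser.reverse []
  have h4 := does_drainZE i o (s.ser ++ e) [] t.ser.reverse []
  simp only [List.append_nil, List.reverse_reverse, List.length_reverse, length_ser] at h1 h2 h3 h4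
  exact (h1.seq (h2.seq (h3.seq h4))).mono (by omega)

/-- The flowchart `P` replaces the topmost tree `s` by `t`, in at most `n` steps. -/
def Maps (P : Frag) (s t : SExp) (n : ℕ) : Prop :=
  ∀ r, P.Does (store [] [] (s.ser ++ r) [] [] []) (store [] [] (t.ser ++ r) [] [] []) n

theorem Maps.mono {P : Frag} {s t : SExp} {n m : ℕ} (h : P.Maps s t n) (hn : n ≤ m) :
    P.Maps s t m := fun r => (h r).mono hn

theorem Maps.seq {P Q : Frag} {s t u : SExp} {n m : ℕ} (hP : P.Maps s t n) (hQ : Q.Maps t u m) :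
    (P.seq Q).Maps s u (n + m) := fun r => (hP r).seq (hQ r)

theorem maps_skip (s : SExp) (n : ℕ) : skip.Maps s s n := fun _ => does_skip _ _

/-- The pair of the results of `P` and `Q`. -/
def fork (P Q : Frag) : Frag :=
  seq dup (seq P (seq swap (seq Q (seq swap (push .e true)))))

/-- `Maps` holds above an arbitrary remainder of the stack, so `P` can run above a spare copy of the
argument and `Q` above the result of `P`. -/
theorem Maps.fork {P Q : Frag} {s t u : SExp} {n m : ℕ} (hP : P.Maps s t n) (hQ : Q.Maps s u m) :
    (P.fork Q).Maps s (.cons t u) (n + m + 19 * s.size + 14 * t.size + 7 * u.size + 18) := by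
  intro r
  refine ((does_dup s _ _ _).seq ((hP _).seq ((does_swap t s _ _ _).seq ((hQ _).seq
    ((does_swap u t _ _ _).seq (?_ : (push .e true).Does _ _ 1)))))).mono (by omega)
  simpa [ser] using does_push_e true [] [] (t.ser ++ (u.ser ++ r)) [] [] []

/-- Push the tree `t`. -/
def lit : SExp → Frag
  | .nil => push .e false
  | .cons a b => seq (lit b) (seq (lit a) (push .e true))

theorem does_lit (t : SExp) (i o e) :
    (lit t).Does (store i o e [] [] []) (store i o (t.ser ++ e) [] [] []) t.size := by
  induction t generalizing e with
  | nil => exact does_push_e _ _ _ _ _ _ _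
  | cons a b iha ihb =>
    have h := ((ihb e).seq ((iha _).seq (does_push_e true _ _ _ _ _ _))).mono
      (m := (SExp.cons a b).size) (by simp [size]; omega)
    simpa [ser, lit] using h

/-- Replace the topmost tree by `t`. -/
def const (t : SExp) : Frag := seq drop (lit t)

theorem maps_const (s t : SExp) : (const t).Maps s t (5 * s.size + 2 + t.size) :=
  fun r => (does_drop s _ _ r _ _).seq (does_lit t _ _ _)

/-- The first component of a pair. -/
def fst : Frag := popCase .e fun _ => seq swap drop

theorem maps_fst (s t : SExp) : fst.Maps (.cons s t) s (12 * (s.size + t.size) + 9) := by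
  intro r
  simp only [ser, List.cons_append, List.append_assoc]
  exact (does_popCase_e ((does_swap s t _ _ _).seq (does_drop t _ _ _ _ _))).mono (by omega)

/-- The second component of a pair. -/
def snd : Frag := popCase .e fun _ => drop

theorem maps_snd (s t : SExp) : snd.Maps (.cons s t) t (5 * s.size + 3) := by
  intro r
  simp only [ser, List.cons_append, List.append_assoc]
  exact (does_popCase_e (does_drop s _ _ _ _ _)).mono (by omega)

/-- Run `P` on a pair and `Q` on the empty tree. -/
def branch (P Q : Frag) : Frag := popCase .e fun
  | some true => seq (push .e true) P
  | _ => seq (push .e false) Q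

theorem maps_branch_cons {P Q : Frag} {s t u : SExp} {n : ℕ} (h : P.Maps (.cons s t) u n) :
    (branch P Q).Maps (.cons s t) u (n + 2) := by
  intro r
  exact (does_popCase_e ((does_push_e true _ _ _ _ _ _).seq (h r))).mono (by omega)

theorem maps_branch_nil {P Q : Frag} {u : SExp} {n : ℕ} (h : Q.Maps .nil u n) :
    (branch P Q).Maps .nil u (n + 2) := by
  intro r
  exact (does_popCase_e ((does_push_e false _ _ _ _ _ _).seq (h r))).mono (by omega)

/-- Run `P` while the first component is a pair. -/
def loop (P : Frag) : Frag :=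
  seq (push .y true) <| whilePop .y fun _ => popCase .e fun _ => popCase .e fun
    | some true => seq (push .e true) (seq (push .e true) (seq P (push .y true)))
    | _ => skip

/-- If `P` performs `n` steps of a loop, each of them in time at most `T`, then the loop works. -/
theorem maps_loop {P : Frag} {T : ℕ} {k : ℕ} (S : ℕ → SExp) (A B C : ℕ → SExp) (D : SExp)
    (hS : ∀ j < k, S j = .cons (.cons (A j) (B j)) (C j)) (hk : S k = .cons .nil D)
    (hP : ∀ j < k, P.Maps (S j) (S (j + 1)) T) :
    (loop P).Maps (S 0) D (k * (T + 6) + 6) := by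
  intro r
  set body : Frag := whilePop .y fun _ => popCase .e fun _ => popCase .e fun
    | some true => seq (push .e true) (seq (push .e true) (seq P (push .y true)))
    | _ => skip with hbody
  -- At each test `y` holds a single marker; every round restores it after `P`, and the final pass
  -- does not.
  have key : ∀ d j, j + d = k → body.Does (store [] [] ((S j).ser ++ r) [] [] [true])
      (store [] [] (D.ser ++ r) [] [] []) (d * (T + 6) + 5) := by
    intro d
    induction d with
    | zero =>
      intro j hj
      obtain rfl : j = k := by omega
      rw [hk]
      refine (does_whilePop_cons (k := .y) (a := true) (r := []) rfl (n := 3)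
        (s' := store [] [] (D.ser ++ r) [] [] []) ?_ (does_whilePop_nil rfl)).mono (by omega)
      rw [update_store_y]
      -- The two pops strip the root and the empty first component, which leaves exactly `D`.
      exact (does_popCase_e (does_popCase_e (does_skip _ 0))).mono (by omega)
    | succ d ih =>
      intro j hj
      refine (does_whilePop_cons (k := .y) (a := true) (r := []) rfl (n := T + 5)
        (s' := store [] [] ((S (j + 1)).ser ++ r) [] [] [true]) ?_
        (ih (j + 1) (by omega))).mono (by rw [Nat.succ_mul]; omega)
      rw [update_store_y]
      have h := hP j (by omega) r
      rw [hS j (by omega)] at h ⊢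
      exact (does_popCase_e (does_popCase_e ((does_push_e true _ _ _ _ _ _).seq
        ((does_push_e true _ _ _ _ _ _).seq (h.seq (does_push_y true _ _ _ _ _ _)))))).mono
        (by omega)
  exact ((does_push_y true _ _ _ _ _ _).seq (key k 0 (by omega))).mono
    (by omega)

end Frag

/-! ### Polynomial bounds -/

/-- `T` is bounded by a polynomial in `μ`. -/
def PolyBound {α : Type} (μ T : α → ℕ) : Prop := ∃ c, ∀ a, T a ≤ (μ a + 2) ^ c

namespace PolyBound

variable {α : Type} {μ T U : α → ℕ}

theorem mono (h : PolyBound μ U) (hT : ∀ a, T a ≤ U a) : PolyBound μ T :=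
  let ⟨c, hc⟩ := h; ⟨c, fun a => (hT a).trans (hc a)⟩

theorem refl (μ : α → ℕ) : PolyBound μ μ := ⟨1, fun a => by simp⟩

theorem const (k : ℕ) : PolyBound μ fun _ => k :=
  ⟨k, fun a => Nat.lt_two_pow_self.le.trans (Nat.pow_le_pow_left (by omega) k)⟩

theorem add (hT : PolyBound μ T) (hU : PolyBound μ U) : PolyBound μ fun a => T a + U a := by
  obtain ⟨c, hc⟩ := hT
  obtain ⟨d, hd⟩ := hU
  -- The base is at least 2, so one more factor pays for the sum of two equal powers.
  refine ⟨max c d + 1, fun a => ?_⟩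
  have h1 := (hc a).trans (Nat.pow_le_pow_right (by omega) (le_max_left c d))
  have h2 := (hd a).trans (Nat.pow_le_pow_right (by omega) (le_max_right c d))
  rw [pow_succ]
  nlinarith [Nat.zero_le ((μ a + 2) ^ max c d * μ a)]

theorem mul (hT : PolyBound μ T) (hU : PolyBound μ U) : PolyBound μ fun a => T a * U a := by
  obtain ⟨c, hc⟩ := hT
  obtain ⟨d, hd⟩ := hU
  exact ⟨c + d, fun a => by rw [pow_add]; exact Nat.mul_le_mul (hc a) (hd a)⟩

theorem pow (hT : PolyBound μ T) (k : ℕ) : PolyBound μ fun a => T a ^ k := by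
  obtain ⟨c, hc⟩ := hT
  exact ⟨c * k, fun a => by rw [pow_mul]; exact Nat.pow_le_pow_left (hc a) k⟩

theorem comp {β : Type} {ν V : β → ℕ} {f : α → β} (hV : PolyBound ν V)
    (hf : PolyBound μ fun a => ν (f a)) : PolyBound μ fun a => V (f a) := by
  obtain ⟨c, hc⟩ := hV
  exact ((hf.add (const 2)).pow c).mono fun a => hc (f a)

end PolyBound

/-! ### Data types coded by trees -/

/-- Types with a code by binary trees. -/
class Enc (α : Type) where
  enc : α → SExp

open Enc (enc)

instance : Enc Unit := ⟨fun _ => .nil⟩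

instance : Enc Bool := ⟨fun b => if b then .cons .nil .nil else .nil⟩

/-- Unary numbers. -/
def encNat : ℕ → SExp
  | 0 => .nil
  | n + 1 => .cons .nil (encNat n)

instance : Enc ℕ := ⟨encNat⟩

instance {α β : Type} [Enc α] [Enc β] : Enc (α × β) := ⟨fun p => .cons (enc p.1) (enc p.2)⟩

/-- The code of a list. -/
def encList {α : Type} [Enc α] : List α → SExp
  | [] => .nil
  | a :: l => .cons (enc a) (encList l)

instance {α : Type} [Enc α] : Enc (List α) := ⟨encList⟩

/-- The size of the code of `a`. -/
def esize {α : Type} [Enc α] (a : α) : ℕ := (enc a).size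

section esize

variable {α β : Type} [Enc α] [Enc β]

theorem esize_prod (p : α × β) : esize p = esize p.1 + esize p.2 + 1 := rfl

theorem esize_pair (a : α) (b : β) : esize (a, b) = esize a + esize b + 1 := rfl

theorem esize_nil : esize ([] : List α) = 1 := rfl

theorem esize_cons (a : α) (l : List α) : esize (a :: l) = esize a + esize l + 1 := rfl

theorem esize_nat (n : ℕ) : esize n = 2 * n + 1 := by
  induction n with
  | zero => rfl
  | succ n ih =>
    have : esize (n + 1) = 1 + esize n + 1 := rfl
    omega

theorem esize_bool (b : Bool) : esize b ≤ 3 := by cases b <;> decide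

theorem esize_pos (a : α) : 1 ≤ esize a := by
  unfold esize
  cases enc a <;> simp [SExp.size]

theorem esize_append (l l' : List α) : esize (l ++ l') + 1 = esize l + esize l' := by
  induction l with
  | nil => simp [esize_nil, add_comm]
  | cons a l ih => simp only [List.cons_append, esize_cons]; omega

theorem length_lt_esize (l : List α) : l.length < esize l := by
  induction l with
  | nil => simp [esize_nil]
  | cons a l ih => simp only [List.length_cons, esize_cons]; omega

theorem esize_le_of_mem {a : α} {l : List α} (h : a ∈ l) : esize a ≤ esize l := by
  induction l with
  | nil => simp at h
  | cons b l ih =>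
    rw [esize_cons]
    rcases List.mem_cons.mp h with rfl | h
    · omega
    · have := ih h; omega

theorem esize_le_of_sublist {l l' : List α} (h : l.Sublist l') : esize l ≤ esize l' := by
  induction h with
  | slnil => rfl
  | cons a _ ih => rw [esize_cons]; omega
  | cons_cons a _ ih => simp only [esize_cons]; omega

theorem esize_le_mul {l : List α} {B : ℕ} (h : ∀ a ∈ l, esize a ≤ B) :
    esize l ≤ l.length * (B + 1) + 1 := by
  induction l with
  | nil => simp [esize_nil]
  | cons a l ih =>
    have h1 := ih fun b hb => h b (List.mem_cons_of_mem _ hb)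
    have h2 := h a List.mem_cons_self
    rw [esize_cons, List.length_cons, Nat.succ_mul]
    omega

end esize

/-! ### Functions computed in bounded time -/

section Bdd

variable {α β γ δ : Type} [Enc α] [Enc β] [Enc γ] [Enc δ] {μ : α → ℕ}

/-- `f` is computed by a flowchart in time polynomial in the measure `μ` of the argument. -/
def Bdd (μ : α → ℕ) (f : α → β) : Prop :=
  ∃ (P : Frag) (T : α → ℕ), PolyBound μ T ∧ PolyBound μ (fun a => esize (f a)) ∧
    ∀ a, P.Maps (enc a) (enc (f a)) (T a)

/-- `f` is computed in polynomial time. -/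
abbrev PolyTime (f : α → β) : Prop := Bdd (fun a => esize a) f

/-- The measure `μ` bounds the size of the argument. -/
class Sized (μ : α → ℕ) : Prop where
  bound : PolyBound μ fun a => esize a

instance : Sized fun a : α => esize a := ⟨.refl _⟩

theorem Bdd.size {f : α → β} (h : Bdd μ f) : PolyBound μ fun a => esize (f a) :=
  let ⟨_, _, _, h, _⟩ := h; h

theorem Bdd.of_eq {f g : α → β} (h : Bdd μ f) (e : ∀ a, f a = g a) : Bdd μ g := by
  rwa [← funext e]

/-- Functions that leave the code unchanged cost nothing. This gives the constructors `cons` and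
`succ` and changes of type. -/
theorem Bdd.of_enc_eq [Sized μ] {f : α → β} (e : ∀ a, enc (f a) = enc a) : Bdd μ f :=
  ⟨.skip, fun _ => 0, .const 0, Sized.bound.mono fun a => by rw [esize, e, esize],
    fun a => by rw [e]; exact Frag.maps_skip _ _⟩

theorem Bdd.id [Sized μ] : Bdd μ fun a => a := .of_enc_eq fun _ => rfl

theorem Bdd.comp {ν : β → ℕ} {g : β → γ} {f : α → β} (hg : Bdd ν g) (hf : Bdd μ f)
    (hν : PolyBound μ fun a => ν (f a)) : Bdd μ fun a => g (f a) := by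
  obtain ⟨P, T, hT, hs, hP⟩ := hf
  obtain ⟨Q, U, hU, hs', hQ⟩ := hg
  exact ⟨P.seq Q, fun a => T a + U (f a), hT.add (hU.comp hν), hs'.comp hν,
    fun a => (hP a).seq (hQ (f a))⟩

/-- The size bound that is part of `Bdd` controls the argument handed to `g`. -/
theorem PolyTime.comp {g : β → γ} {f : α → β} (hg : PolyTime g) (hf : Bdd μ f) :
    Bdd μ fun a => g (f a) := Bdd.comp hg hf hf.size

theorem Bdd.pair [hμ : Sized μ] {f : α → β} {g : α → γ} (hf : Bdd μ f) (hg : Bdd μ g) :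
    Bdd μ fun a => (f a, g a) := by
  obtain ⟨P, T, hT, hs, hP⟩ := hf
  obtain ⟨Q, U, hU, hs', hQ⟩ := hg
  exact ⟨P.fork Q, fun a => T a + U a + 19 * esize a + 14 * esize (f a) + 7 * esize (g a) + 18,
    (((((hT.add hU).add ((PolyBound.const 19).mul hμ.bound)).add ((PolyBound.const 14).mul hs)).add
      ((PolyBound.const 7).mul hs')).add (.const 18)),
    (hs.add hs').add (.const 1), fun a => (hP a).fork (hQ a)⟩

theorem Bdd.const [hμ : Sized μ] (b : β) : Bdd μ fun _ => b :=
  ⟨.const (enc b), fun a => 5 * esize a + 2 + esize b,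
    ((((PolyBound.const 5).mul hμ.bound).add (.const 2)).add (.const _)), .const _,
    fun _ => Frag.maps_const _ _⟩

theorem polyTime_fst : PolyTime (Prod.fst : α × β → α) :=
  ⟨.fst, fun p => 12 * esize p + 9, (((PolyBound.const 12).mul (.refl _)).add (.const 9)),
    (PolyBound.refl _).mono fun p => by rw [esize_prod]; omega,
    fun p => (Frag.maps_fst _ _).mono (by dsimp only; rw [esize_prod]; unfold esize; omega)⟩

theorem polyTime_snd : PolyTime (Prod.snd : α × β → β) :=
  ⟨.snd, fun p => 5 * esize p + 3, (((PolyBound.const 5).mul (.refl _)).add (.const 3)),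
    (PolyBound.refl _).mono fun p => by rw [esize_prod]; omega,
    fun p => (Frag.maps_snd _ _).mono (by dsimp only; rw [esize_prod]; unfold esize; omega)⟩

theorem Bdd.fst {f : α → β × γ} (hf : Bdd μ f) : Bdd μ fun a => (f a).1 := polyTime_fst.comp hf

theorem Bdd.snd {f : α → β × γ} (hf : Bdd μ f) : Bdd μ fun a => (f a).2 := polyTime_snd.comp hf

/-! #### Booleans -/

/-- Branching on the first component of a pair. -/
def Frag.condFst (P Q : Frag) : Frag := .popCase .e fun _ => .popCase .e fun
  -- The outer pops remove the root of the pair and read the root of the Boolean; these two remove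
  -- the leaves below `true`.
  | some true => .popCase .e fun _ => .popCase .e fun _ => P
  | _ => Q

theorem Frag.maps_condFst {P Q : Frag} {b : Bool} {s t : SExp} {n : ℕ}
    (hP : b = true → P.Maps s t n) (hQ : b = false → Q.Maps s t n) :
    (condFst P Q).Maps (.cons (enc b) s) t (n + 4) := by
  intro r
  cases b with
  | false => exact (does_popCase_e (does_popCase_e (hQ rfl r))).mono (by omega)
  | true => exact does_popCase_e (does_popCase_e (does_popCase_e (does_popCase_e (hP rfl r))))

theorem Bdd.cond [hμ : Sized μ] {c : α → Bool} {f g : α → β} (hc : Bdd μ c) (hf : Bdd μ f)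
    (hg : Bdd μ g) : Bdd μ fun a => bif c a then f a else g a := by
  obtain ⟨P, T, hT, hs, hP⟩ := hc.pair .id
  obtain ⟨Q₁, T₁, hT₁, hs₁, hQ₁⟩ := hf
  obtain ⟨Q₂, T₂, hT₂, hs₂, hQ₂⟩ := hg
  refine ⟨P.seq (.condFst Q₁ Q₂), fun a => T a + ((T₁ a + T₂ a) + 4),
    hT.add ((hT₁.add hT₂).add (.const 4)), (hs₁.add hs₂).mono fun a => ?_,
    fun a => (hP a).seq (Frag.maps_condFst (fun h => ?_) fun h => ?_)⟩
  · dsimp only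
    cases c a
    · exact Nat.le_add_left _ _
    · exact Nat.le_add_right _ _
  · dsimp only at h ⊢; rw [h]; exact (hQ₁ a).mono (by omega)
  · dsimp only at h ⊢; rw [h]; exact (hQ₂ a).mono (by omega)

theorem Bdd.and [Sized μ] {f g : α → Bool} (hf : Bdd μ f) (hg : Bdd μ g) :
    Bdd μ fun a => f a && g a :=
  (hf.cond hg (.const false)).of_eq fun a => by cases f a <;> rfl

theorem Bdd.or [Sized μ] {f g : α → Bool} (hf : Bdd μ f) (hg : Bdd μ g) :
    Bdd μ fun a => f a || g a :=
  (hf.cond (.const true) hg).of_eq fun a => by cases f a <;> rfl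

theorem Bdd.not [Sized μ] {f : α → Bool} (hf : Bdd μ f) : Bdd μ fun a => !(f a) :=
  (hf.cond (.const false) (.const true)).of_eq fun a => by cases f a <;> rfl

/-! #### Lists -/

theorem Bdd.cons [Sized μ] {f : α → β} {g : α → List β} (hf : Bdd μ f) (hg : Bdd μ g) :
    Bdd μ fun a => f a :: g a :=
  PolyTime.comp (g := fun p : β × List β => p.1 :: p.2) (.of_enc_eq fun _ => rfl) (hf.pair hg)

theorem polyTime_isEmpty : PolyTime (List.isEmpty : List α → Bool) :=
  ⟨.branch (.const (enc false)) (.const (enc true)), fun l => 5 * esize l + 7,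
    (((PolyBound.const 5).mul (.refl _)).add (.const 7)),
    (PolyBound.const 3).mono fun l => esize_bool _, fun l => by
      cases l with
      | nil => exact (Frag.maps_branch_nil (Frag.maps_const _ _)).mono le_rfl
      | cons a l =>
        refine (Frag.maps_branch_cons (Frag.maps_const _ _)).mono ?_
        change _ ≤ 5 * ((enc a).size + (encList l).size + 1) + 7
        have : (enc false).size = 1 := rfl
        simp only [SExp.size]
        omega⟩

theorem Bdd.isEmpty {l : α → List β} (hl : Bdd μ l) : Bdd μ fun a => (l a).isEmpty :=
  polyTime_isEmpty.comp hl

theorem polyTime_tail : PolyTime (List.tail : List α → List α) :=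
  ⟨.branch .snd .skip, fun l => 5 * esize l + 5, (((PolyBound.const 5).mul (.refl _)).add (.const 5)),
    (PolyBound.refl _).mono fun l => esize_le_of_sublist (List.tail_sublist l), fun l => by
      cases l with
      | nil => exact (Frag.maps_branch_nil (Frag.maps_skip _ 0)).mono (by dsimp only; omega)
      | cons a l =>
        refine (Frag.maps_branch_cons (Frag.maps_snd _ _)).mono ?_
        dsimp only; rw [esize_cons]; unfold esize; omega⟩

theorem Bdd.tail {l : α → List β} (hl : Bdd μ l) : Bdd μ fun a => (l a).tail :=
  polyTime_tail.comp hl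

theorem polyTime_headD (d : α) : PolyTime fun l : List α => l.headD d :=
  ⟨.branch .fst (.const (enc d)), fun l => 12 * esize l + 11 + esize d,
    ((((PolyBound.const 12).mul (.refl _)).add (.const 11)).add (.const _)),
    ((PolyBound.refl _).add (.const (esize d))).mono fun l => by
      cases l with
      | nil => simp
      | cons a l => simp only [List.headD_cons, esize_cons]; omega, fun l => by
      cases l with
      | nil =>
        refine (Frag.maps_branch_nil (Frag.maps_const _ _)).mono ?_
        simp only [SExp.size, esize]; omega
      | cons a l =>
        refine (Frag.maps_branch_cons (Frag.maps_fst _ _)).mono ?_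
        change _ ≤ 12 * ((enc a).size + (encList l).size + 1) + 11 + esize d
        omega⟩

theorem Bdd.headD {l : α → List β} (hl : Bdd μ l) (d : β) : Bdd μ fun a => (l a).headD d :=
  (polyTime_headD d).comp hl

/-- The loop state consists of the remaining list, the accumulator and the argument. Iterating a
polynomial-time step may produce exponential size, hence the separate bound `B` on all intermediate
accumulators. -/
theorem Bdd.foldl [hμ : Sized μ] {l : α → List β} {i : α → γ} {h : α → γ → β → γ} (hl : Bdd μ l)
    (hi : Bdd μ i) (hh : PolyTime fun p : (α × γ) × β => h p.1.1 p.1.2 p.2) {B : α → ℕ}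
    (hB : PolyBound μ B) (hb : ∀ a t, t <+: l a → esize (t.foldl (h a) (i a)) ≤ B a) :
    Bdd μ fun a => (l a).foldl (h a) (i a) := by
  have hbody : PolyTime fun p : (β × List β) × (γ × α) =>
      (p.1.2, (h p.2.2 p.2.1 p.1.1, p.2.2)) :=
    .pair (.snd (.fst .id)) (.pair (hh.comp (.pair (.pair (.snd (.snd .id)) (.fst (.snd .id)))
      (.fst (.fst .id)))) (.snd (.snd .id)))
  obtain ⟨P, T, hT, hs, hP⟩ := hl.pair (hi.pair .id)
  obtain ⟨Q, U, ⟨c, hU⟩, -, hQ⟩ := hbody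
  -- `V` bounds the time of any round: the first summands and one 2 bound the size of the state, the
  -- other 2 belongs to `PolyBound`.
  obtain ⟨V, hV⟩ : ∃ V : α → ℕ, V = fun a => (esize (l a) + B a + esize a + 2 + 2) ^ c := ⟨_, rfl⟩
  have hV' : PolyBound μ V := by
    rw [hV]
    exact ((((hl.size.add hB).add hμ.bound).add (.const 2)).add (.const 2)).pow c
  refine ⟨P.seq ((Frag.loop Q).seq .fst),
    fun a => T a + ((esize (l a) * (V a + 6) + 6) + (12 * (B a + esize a) + 9)),
    hT.add (((hl.size.mul (hV'.add (.const 6))).add (.const 6)).add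
      (((PolyBound.const 12).mul (hB.add hμ.bound)).add (.const 9))),
    hB.mono fun a => hb a _ (List.prefix_refl _), fun a => (hP a).seq (.seq (t := enc ((l a).foldl (h a) (i a), a)) ?_ ?_)⟩
  · let acc : ℕ → γ := fun j => ((l a).take j).foldl (h a) (i a)
    have hacc : ∀ j, esize (acc j) ≤ B a := fun j => hb a _ (List.take_prefix j _)
    have key := Frag.maps_loop (P := Q) (T := V a) (k := (l a).length)
      (fun j => enc ((l a).drop j, (acc j, a)))
      (fun j => if hj : j < (l a).length then enc ((l a)[j]) else .nil)
      (fun j => enc ((l a).drop (j + 1))) (fun j => enc (acc j, a)) (enc (acc (l a).length, a))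
      (fun j hj => by
        simp only [hj, dite_true]
        rw [List.drop_eq_getElem_cons hj]
        rfl)
      (by
        rw [List.drop_length]
        rfl)
      (fun j hj => by
        have h1 := hQ ((((l a)[j], (l a).drop (j + 1)), (acc j, a)))
        have h2 : acc (j + 1) = h a (acc j) (l a)[j] := by
          simp only [acc, List.take_succ_eq_append_getElem hj, List.foldl_append, List.foldl_cons,
            List.foldl_nil]
        show Q.Maps (enc ((l a).drop j, (acc j, a))) (enc ((l a).drop (j + 1), (acc (j + 1), a))) _
        rw [h2, List.drop_eq_getElem_cons hj]
        refine Frag.Maps.mono h1 ((hU _).trans ?_)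
        rw [hV]
        refine Nat.pow_le_pow_left ?_ c
        have h3 := esize_le_of_sublist (List.drop_sublist j (l a))
        rw [List.drop_eq_getElem_cons hj, esize_cons] at h3
        have h4 := hacc j
        simp only [esize_pair]
        omega)
    refine Frag.Maps.mono (t := enc ((l a).foldl (h a) (i a), a)) ?_ (Nat.add_le_add_right
      (Nat.mul_le_mul_right _ (length_lt_esize (l a)).le) _)
    simpa only [acc, List.take_length, List.drop_zero, List.take_zero, List.foldl_nil] using key
  · refine (Frag.maps_fst _ _).mono ?_
    have := hb a _ (List.prefix_refl _)
    unfold esize at this ⊢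
    dsimp only at this ⊢
    omega

/-- A fold whose steps add at most a polynomial to the size. -/
theorem Bdd.foldl_of_add [hμ : Sized μ] {l : α → List β} {i : α → γ} {h : α → γ → β → γ}
    (hl : Bdd μ l) (hi : Bdd μ i) (hh : PolyTime fun p : (α × γ) × β => h p.1.1 p.1.2 p.2)
    {B : α × β → ℕ} (hB : PolyBound (fun p => esize p) B)
    (hb : ∀ a s b, esize (h a s b) ≤ esize s + B (a, b)) :
    Bdd μ fun a => (l a).foldl (h a) (i a) := by
  obtain ⟨c, hc⟩ := hB
  refine hl.foldl hi hh
    (B := fun a => esize (i a) + esize (l a) * (esize a + esize (l a) + 1 + 2) ^ c)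
    (hi.size.add (hl.size.mul ((((hμ.bound.add hl.size).add (.const 1)).add (.const 2)).pow c)))
    fun a t ht => ?_
  have key : ∀ (t : List β) (s : γ), (∀ b ∈ t, esize b ≤ esize (l a)) →
      esize (t.foldl (h a) s) ≤ esize s + t.length * (esize a + esize (l a) + 1 + 2) ^ c := by
    intro t
    induction t with
    | nil => intro s _; simp
    | cons b t ih =>
      intro s hs
      rw [List.foldl_cons, List.length_cons, Nat.succ_mul]
      have h1 := ih (h a s b) fun b hb => hs b (List.mem_cons_of_mem _ hb)
      have h2 := (hb a s b).trans (Nat.add_le_add_left (hc (a, b)) _)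
      have h3 : (esize (a, b) + 2) ^ c ≤ (esize a + esize (l a) + 1 + 2) ^ c := by
        refine Nat.pow_le_pow_left ?_ c
        have := hs b List.mem_cons_self
        rw [esize_pair]
        omega
      dsimp only at h2
      omega
  refine (key t (i a) fun b hb => esize_le_of_mem (ht.subset hb)).trans ?_
  exact Nat.add_le_add_left (Nat.mul_le_mul_right _
    (ht.length_le.trans (length_lt_esize _).le)) _

theorem Bdd.reverse [Sized μ] {l : α → List β} (hl : Bdd μ l) : Bdd μ fun a => (l a).reverse :=
  Bdd.of_eq (Bdd.foldl_of_add (h := fun _ s b => b :: s) hl (.const [])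
    (.cons (.snd .id) (.snd (.fst .id))) (B := fun p => esize p) (.refl _)
    fun a s b => by rw [esize_cons, esize_pair]; omega) fun a => by simp

theorem Bdd.append [Sized μ] {l l' : α → List β} (hl : Bdd μ l) (hl' : Bdd μ l') :
    Bdd μ fun a => l a ++ l' a :=
  Bdd.of_eq (Bdd.foldl_of_add (h := fun _ s b => b :: s) hl.reverse hl'
    (.cons (.snd .id) (.snd (.fst .id))) (B := fun p => esize p) (.refl _)
    fun a s b => by rw [esize_cons, esize_pair]; omega) fun a => by simp

theorem Bdd.flatMap [Sized μ] {l : α → List β} {f : α → β → List γ} (hl : Bdd μ l)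
    (hf : PolyTime fun p : α × β => f p.1 p.2) : Bdd μ fun a => (l a).flatMap (f a) :=
  Bdd.of_eq (Bdd.foldl_of_add (h := fun a s b => s ++ f a b) hl (.const [])
    (.append (.snd (.fst .id)) (hf.comp (.pair (.fst (.fst .id)) (.snd .id)))) hf.size
    fun a s b => by have := esize_append s (f a b); dsimp only; omega) fun a => by
      rw [List.flatMap_eq_foldl]

theorem Bdd.map [Sized μ] {l : α → List β} {f : α → β → γ} (hl : Bdd μ l)
    (hf : PolyTime fun p : α × β => f p.1 p.2) : Bdd μ fun a => (l a).map (f a) :=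
  (hl.flatMap (f := fun a b => [f a b]) (.cons hf (.const []))).of_eq fun a => by
    exact List.flatMap_pure_eq_map _ _

theorem Bdd.filter [Sized μ] {l : α → List β} {f : α → β → Bool} (hl : Bdd μ l)
    (hf : PolyTime fun p : α × β => f p.1 p.2) : Bdd μ fun a => (l a).filter (f a) :=
  (hl.flatMap (f := fun a b => bif f a b then [b] else [])
    (.cond hf (.cons (.snd .id) (.const [])) (.const []))).of_eq fun a => by
    induction l a with
    | nil => rfl
    | cons b t ih => cases h : f a b <;> simp [h, ih]

theorem Bdd.any [Sized μ] {l : α → List β} {f : α → β → Bool} (hl : Bdd μ l)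
    (hf : PolyTime fun p : α × β => f p.1 p.2) : Bdd μ fun a => (l a).any (f a) :=
  (hl.filter hf).isEmpty.not.of_eq fun a => by
    induction l a with
    | nil => rfl
    | cons b t ih => cases h : f a b <;> simp_all

theorem Bdd.all [Sized μ] {l : α → List β} {f : α → β → Bool} (hl : Bdd μ l)
    (hf : PolyTime fun p : α × β => f p.1 p.2) : Bdd μ fun a => (l a).all (f a) :=
  (hl.any (f := fun a b => !(f a b)) hf.not).not.of_eq fun a => by
    simp [List.all_eq_not_any_not]

/-! #### Natural numbers -/

theorem Bdd.succ [Sized μ] {f : α → ℕ} (hf : Bdd μ f) : Bdd μ fun a => f a + 1 :=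
  PolyTime.comp (g := fun p : Unit × ℕ => p.2 + 1) (.of_enc_eq fun _ => rfl)
    (Bdd.pair (.const ()) hf)

/-- A unary number and a list of units have the same code, so arithmetic reduces to list operations.
-/
theorem enc_replicate (n : ℕ) : enc (List.replicate n ()) = enc n := by
  induction n with
  | zero => rfl
  | succ n ih => exact congrArg (SExp.cons .nil) ih

theorem Bdd.replicate {f : α → ℕ} (hf : Bdd μ f) : Bdd μ fun a => List.replicate (f a) () :=
  PolyTime.comp (g := fun n => List.replicate n ()) (.of_enc_eq enc_replicate) hf

theorem Bdd.length [Sized μ] {l : α → List β} (hl : Bdd μ l) : Bdd μ fun a => (l a).length :=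
  Bdd.of_eq (Bdd.foldl_of_add (h := fun _ s _ => s + 1) hl (.const 0) (.succ (.snd (.fst .id)))
    (B := fun _ => 2) (.const 2) fun a s b => by simp only [esize_nat]; omega) fun a => by
      simp

/-- Iteration is a fold over `n a` units; since numbers are coded in unary, their count is
polynomial. -/
theorem Bdd.iterate [hμ : Sized μ] {n : α → ℕ} {i : α → γ} {h : α → γ → γ} (hn : Bdd μ n)
    (hi : Bdd μ i) (hh : PolyTime fun p : α × γ => h p.1 p.2) {B : α → ℕ} (hB : PolyBound μ B)
    (hb : ∀ a, ∀ j ≤ n a, esize ((h a)^[j] (i a)) ≤ B a) : Bdd μ fun a => (h a)^[n a] (i a) := by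
  have e : ∀ (l : List Unit) a s, l.foldl (fun s _ => h a s) s = (h a)^[l.length] s := by
    intro l
    induction l with
    | nil => intro a s; rfl
    | cons b l ih => intro a s; rw [List.foldl_cons, ih]; rfl
  refine (Bdd.foldl (h := fun a s _ => h a s) hn.replicate hi (hh.comp (.fst .id)) hB
    fun a t ht => ?_).of_eq fun a => by rw [e, List.length_replicate]
  rw [e]
  exact hb a _ (by simpa using ht.length_le)

theorem Bdd.pred [Sized μ] {f : α → ℕ} (hf : Bdd μ f) : Bdd μ fun a => f a - 1 :=
  (hf.replicate.tail.length).of_eq fun a => by simp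

theorem Bdd.add [Sized μ] {f g : α → ℕ} (hf : Bdd μ f) (hg : Bdd μ g) :
    Bdd μ fun a => f a + g a :=
  (hf.replicate.append hg.replicate).length.of_eq fun a => by simp

theorem iterate_pred (n k : ℕ) : (fun s => s - 1)^[k] n = n - k := by
  induction k with
  | zero => rfl
  | succ k ih => rw [iterate_succ_apply', ih]; omega

theorem Bdd.sub [Sized μ] {f g : α → ℕ} (hf : Bdd μ f) (hg : Bdd μ g) :
    Bdd μ fun a => f a - g a :=
  Bdd.of_eq (Bdd.iterate (h := fun _ s => s - 1) hg hf (.pred (.snd .id)) hf.size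
    fun a j _ => by rw [iterate_pred]; simp only [esize_nat]; omega) fun a => by
      rw [iterate_pred]

theorem Bdd.min [Sized μ] {f g : α → ℕ} (hf : Bdd μ f) (hg : Bdd μ g) :
    Bdd μ fun a => min (f a) (g a) :=
  (hf.sub (hf.sub hg)).of_eq fun a => by omega

theorem Bdd.decide_le [Sized μ] {f g : α → ℕ} (hf : Bdd μ f) (hg : Bdd μ g) :
    Bdd μ fun a => decide (f a ≤ g a) :=
  (hf.sub hg).replicate.isEmpty.of_eq fun a => by
    rw [Bool.eq_iff_iff]; simp [Nat.sub_eq_zero_iff_le]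

theorem Bdd.decide_eq [Sized μ] {f g : α → ℕ} (hf : Bdd μ f) (hg : Bdd μ g) :
    Bdd μ fun a => decide (f a = g a) :=
  ((hf.decide_le hg).and (hg.decide_le hf)).of_eq fun a => by
    rw [Bool.eq_iff_iff]; simp [le_antisymm_iff]

end Bdd

/-! ### Reading the input and writing the output -/

/-- Is the symbol a separator? -/
def InputSymbol.isSep : InputSymbol → Bool
  | bit _ => false
  | _ => true

/-- The value of a bit; for separators, whether it is a semicolon. -/
def InputSymbol.val : InputSymbol → Bool
  | bit b => b
  | comma => false
  | semi => true

instance : Enc InputSymbol := ⟨fun s => enc (s.isSep, s.val)⟩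

/-- Reading moves the input symbol by symbol onto the main stack, which reverses it. -/
instance : Enc Instance := ⟨fun I => enc I.encode.reverse⟩

theorem esize_inputSymbol (s : InputSymbol) : esize s ≤ 7 := by
  have h1 := esize_bool s.isSep
  have h2 := esize_bool s.val
  have : esize s = esize (s.isSep, s.val) := rfl
  rw [this, esize_pair]
  omega

theorem esize_instance_le (I : Instance) : esize I ≤ 8 * I.encode.length + 1 := by
  have : esize I = esize I.encode.reverse := rfl
  have h := esize_le_mul (l := I.encode.reverse) fun s _ => esize_inputSymbol s
  rw [List.length_reverse] at h
  omega

theorem length_encode_pos (I : Instance) : 0 < I.encode.length := by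
  simp only [Instance.encode, encodeNumber, List.length_append, List.length_singleton]
  omega

namespace Frag

/-- Read the input and push the code of its reversal. -/
def read : Frag :=
  seq (push .e false) <| whilePop .inp fun s => seq (lit (enc s)) (push .e true)

theorem does_read (i : List InputSymbol) (r : List Bool) :
    read.Does (store i [] r [] [] []) (store [] [] ((enc i.reverse).ser ++ r) [] [] [])
      (9 * i.length + 2) := by
  have key : ∀ i l : List InputSymbol,
      (whilePop .inp fun s => seq (lit (enc s)) (push .e true)).Does
        (store i [] ((enc l).ser ++ r) [] [] [])
        (store [] [] ((enc (i.reverse ++ l)).ser ++ r) [] [] []) (9 * i.length + 1) := by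
    intro i
    induction i with
    | nil => intro l; exact does_whilePop_nil rfl
    | cons s i ih =>
      intro l
      -- The code of a symbol has at most 7 tokens, and one more joins it to the list.
      refine (does_whilePop_cons (k := .inp) (a := s) (r := i) rfl (n := 8)
        (s' := store i [] ((enc (s :: l)).ser ++ r) [] [] []) ?_
        (by simpa using ih (s :: l))).mono (by simp; omega)
      rw [update_store_inp]
      refine ((does_lit (enc s) _ _ _).seq (?_ : (push .e true).Does _ _ 1)).mono
        (Nat.succ_le_succ (esize_inputSymbol s))
      have h : (enc (s :: l)).ser ++ r = true :: ((enc s).ser ++ ((enc l).ser ++ r)) := by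
        change (SExp.cons (enc s) (enc l)).ser ++ r = _
        simp [SExp.ser]
      rw [h]
      exact does_push_e _ _ _ _ _ _ _
  refine ((does_push_e false _ _ _ _ _ _).seq (?_ : Does _ _ _ (9 * i.length + 1))).mono (by omega)
  have h := key i []
  rw [List.append_nil] at h
  exact h

/-- Move a truth value from the main stack to the output. -/
def write : Frag := popCase .e fun
  | some true => popCase .e fun _ => popCase .e fun _ => push .out true
  | _ => push .out false

theorem does_write (b : Bool) :
    write.Does (store [] [] (enc b).ser [] [] []) (store [] [b] [] [] [] []) 4 := by
  cases b with
  | false => exact (does_popCase_e (does_push_out false _ _ _ _ _ _)).mono (by omega)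
  | true =>
    exact does_popCase_e (does_popCase_e (does_popCase_e (does_push_out true _ _ _ _ _ _)))

end Frag

theorem DecidableInTime.mono {α Γ : Type} {enc : α → List Γ} {P : α → Prop} {T U : α → ℕ}
    (h : DecidableInTime enc P T) (hU : ∀ a, T a ≤ U a) : DecidableInTime enc P U := by
  obtain ⟨M, hM, h⟩ := h
  refine ⟨M, hM, fun a => ?_⟩
  obtain ⟨b, hb, ⟨o⟩⟩ := h a
  exact ⟨b, hb, ⟨⟨o.toEvalsTo, o.steps_le_m.trans (hU a)⟩⟩⟩

theorem Bdd.decidableInTime {μ : Instance → ℕ} {f : Instance → Bool} {p : Instance → Prop}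
    (hμ : ∀ I : Instance, I.encode.length ≤ μ I) (hf : Bdd μ f) (hp : ∀ I, f I = true ↔ p I) :
    ∃ c, DecidableInTime Instance.encode p fun I => (μ I + 2) ^ c := by
  obtain ⟨P, T, hT, -, hP⟩ := hf
  obtain ⟨c, hc⟩ : PolyBound μ fun I => (9 * μ I + 2) + (T I + 4) + 1 :=
    ((((PolyBound.const 9).mul (.refl _)).add (.const 2)).add (hT.add (.const 4))).add (.const 1)
  refine ⟨c, (Frag.decidableInTime (Frag.read.seq (P.seq Frag.write))
    (T := fun I => (9 * I.encode.length + 2) + (T I + 4)) f hp fun I => ?_).mono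
    fun I => le_trans ?_ (hc I)⟩
  · have h1 := Frag.does_read I.encode []
    have h2 := hP I []
    rw [List.append_nil] at h1 h2
    rw [List.append_nil] at h2
    exact h1.seq (h2.seq (Frag.does_write _))
  · have := hμ I
    dsimp only
    omega

/-! ### Parsing -/

/-- The state of the parser: the current number (most significant digit first), the current row
and the finished rows, both last entry first. -/
abbrev ParseState := List Bool × List (List Bool) × List (List (List Bool))

/-- One step of the parser. -/
def parseStep (s : ParseState) (c : InputSymbol) : ParseState :=
  bif c.isSep then (bif c.val then ([], [], s.2.1 :: s.2.2) else ([], s.1 :: s.2.1, s.2.2))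
  else (c.val :: s.1, s.2.1, s.2.2)

/-- The value of a binary number, most significant digit first, capped at `b`. -/
def cappedValue (b : ℕ) (l : List Bool) : ℕ :=
  l.foldl (fun v d => min b (v + v + bif d then 1 else 0)) 0

/-- The rows of numbers of the input, capped at the length of the input. -/
def Instance.rows (I : Instance) : List (List ℕ) :=
  ((I.encode.foldl parseStep ([], [], [])).2.2.map fun r =>
    (r.map (cappedValue I.encode.length)).reverse).reverse

theorem polyTime_encode : PolyTime Instance.encode :=
  Bdd.of_eq (f := fun I : Instance => I.encode.reverse.reverse)
    (.reverse (.of_enc_eq fun _ => rfl)) fun _ => List.reverse_reverse _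

theorem polyTime_isSep : PolyTime InputSymbol.isSep :=
  Bdd.fst (f := fun s : InputSymbol => (s.isSep, s.val)) (.of_enc_eq fun _ => rfl)

theorem polyTime_val : PolyTime InputSymbol.val :=
  Bdd.snd (f := fun s : InputSymbol => (s.isSep, s.val)) (.of_enc_eq fun _ => rfl)

theorem polyTime_parseStep : PolyTime fun p : ParseState × InputSymbol => parseStep p.1 p.2 :=
  .cond (polyTime_isSep.comp (.snd .id))
    (.cond (polyTime_val.comp (.snd .id))
      (.pair (.const []) (.pair (.const [])
        (.cons (.fst (.snd (.fst .id))) (.snd (.snd (.fst .id))))))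
      (.pair (.const []) (.pair (.cons (.fst (.fst .id)) (.fst (.snd (.fst .id))))
        (.snd (.snd (.fst .id))))))
    (.pair (.cons (polyTime_val.comp (.snd .id)) (.fst (.fst .id)))
      (.pair (.fst (.snd (.fst .id))) (.snd (.snd (.fst .id)))))

theorem esize_parseStep (s : ParseState) (c : InputSymbol) :
    esize (parseStep s c) ≤ esize s + 4 := by
  have h1 := esize_bool c.val
  have h2 := esize_pos s.1
  have h3 := esize_pos s.2.1
  unfold parseStep
  cases c.isSep <;> cases h : c.val <;>
    simp only [cond_true, cond_false, esize_prod, esize_cons, esize_nil, h] at h1 ⊢ <;> omega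

/-- A binary input may denote a number exponential in its length, while trees hold numbers in unary.
Capping after every digit keeps all accumulators at most `p.1`. -/
theorem polyTime_cappedValue : PolyTime fun p : ℕ × List Bool => cappedValue p.1 p.2 :=
  Bdd.foldl (l := fun p : ℕ × List Bool => p.2) (i := fun _ => 0)
    (h := fun p v d => min p.1 (v + v + bif d then 1 else 0)) (.snd .id) (.const 0)
    (.min (.fst (.fst (.fst .id))) (.add (.add (.snd (.fst .id)) (.snd (.fst .id)))
      (.cond (.snd .id) (.const 1) (.const 0)))) (B := fun p => esize p) (.refl _)
    fun p t _ => by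
      have : ∀ (t : List Bool) (v : ℕ), v ≤ p.1 →
          t.foldl (fun v d => min p.1 (v + v + bif d then 1 else 0)) v ≤ p.1 := by
        intro t
        induction t with
        | nil => exact fun v hv => hv
        | cons d t ih => exact fun v _ => ih _ (min_le_left _ _)
      have := this t 0 (Nat.zero_le _)
      rw [esize_prod, esize_nat, esize_nat]
      omega

theorem polyTime_parse :
    PolyTime fun I : Instance => I.encode.foldl parseStep ([], [], []) :=
  Bdd.foldl_of_add (h := fun _ s c => parseStep s c) polyTime_encode (.const ([], [], []))
    (PolyTime.comp (g := fun p : ParseState × InputSymbol => parseStep p.1 p.2) polyTime_parseStep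
      (f := fun p : (Instance × ParseState) × InputSymbol => (p.1.2, p.2))
      (.pair (.snd (.fst .id)) (.snd .id)))
    (B := fun _ => 4) (.const 4) fun _ s c => esize_parseStep s c

theorem polyTime_cappedValue_row :
    PolyTime fun p : ℕ × List (List Bool) => (p.2.map (cappedValue p.1)).reverse :=
  Bdd.reverse (.map (f := fun p l => cappedValue p.1 l) (.snd .id)
    (PolyTime.comp (g := fun p : ℕ × List Bool => cappedValue p.1 p.2) polyTime_cappedValue
      (f := fun p : (ℕ × List (List Bool)) × List Bool => (p.1.1, p.2))
      (.pair (.fst (.fst .id)) (.snd .id))))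

theorem polyTime_rows : PolyTime Instance.rows := by
  have h : PolyTime fun p : Instance × List (List Bool) =>
      (p.2.map (cappedValue p.1.encode.length)).reverse :=
    PolyTime.comp (g := fun p : ℕ × List (List Bool) => (p.2.map (cappedValue p.1)).reverse)
      polyTime_cappedValue_row
      (f := fun p : Instance × List (List Bool) => (p.1.encode.length, p.2))
      (.pair (.length (polyTime_encode.comp (.fst .id))) (.snd .id))
  have h' := Bdd.reverse (Bdd.map (f := fun (I : Instance) r =>
    (r.map (cappedValue I.encode.length)).reverse) (.snd (.snd polyTime_parse)) h)
  exact h'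

theorem foldl_parseStep_bits (l : List Bool) (s : ParseState) :
    (l.map InputSymbol.bit).foldl parseStep s = (l.reverse ++ s.1, s.2) := by
  induction l generalizing s with
  | nil => rfl
  | cons b l ih => simp [ih, parseStep, InputSymbol.isSep, InputSymbol.val]

theorem foldl_parseStep_number (k : ℕ) (s : ParseState) :
    (encodeNumber k).foldl parseStep s =
      ([], ((Computability.encodeNat k).reverse ++ s.1) :: s.2.1, s.2.2) := by
  rw [encodeNumber, List.foldl_append, foldl_parseStep_bits]
  rfl

theorem foldl_parseStep_flatMap (l : List ℕ) (row : List (List Bool))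
    (rows : List (List (List Bool))) :
    (l.flatMap encodeNumber).foldl parseStep ([], row, rows) =
      ([], (l.map fun k => (Computability.encodeNat k).reverse).reverse ++ row, rows) := by
  induction l generalizing row with
  | nil => rfl
  | cons k l ih =>
    rw [List.flatMap_cons, List.foldl_append, foldl_parseStep_number, List.append_nil, ih]
    simp

theorem foldl_parseStep_numbers (l : List ℕ) (row : List (List Bool))
    (rows : List (List (List Bool))) :
    (encodeNumbers l).foldl parseStep ([], row, rows) =
      ([], [], ((l.map fun k => (Computability.encodeNat k).reverse).reverse ++ row) :: rows) := by
  rw [encodeNumbers, List.foldl_append, foldl_parseStep_flatMap]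
  rfl

theorem foldl_parseStep_rows (L : List (List ℕ)) (rows : List (List (List Bool))) :
    (L.flatMap encodeNumbers).foldl parseStep ([], [], rows) = ([], [],
      (L.map fun l => (l.map fun k => (Computability.encodeNat k).reverse).reverse).reverse ++
        rows) := by
  induction L generalizing rows with
  | nil => rfl
  | cons l L ih =>
    rw [List.flatMap_cons, List.foldl_append, foldl_parseStep_numbers, List.append_nil, ih]
    simp

/-- Capping at every digit agrees with capping once at the end, since `min b (2 * min b v + d) = min
b (2 * v + d)`. -/
theorem cappedValue_encodeNat (b k : ℕ) :
    cappedValue b (Computability.encodeNat k).reverse = min b k := by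
  have key : ∀ p : PosNum, (Computability.encodePosNum p).foldr
      (fun d v => min b (v + v + bif d then 1 else 0)) 0 = min b (p : ℕ) := by
    intro p
    induction p with
    | one => rfl
    | bit0 p ih =>
      rw [Computability.encodePosNum, List.foldr_cons, ih, PosNum.cast_bit0]
      simp only [cond_false]
      omega
    | bit1 p ih =>
      rw [Computability.encodePosNum, List.foldr_cons, ih, PosNum.cast_bit1]
      simp only [cond_true]
      omega
  rw [cappedValue, List.foldl_reverse, Computability.encodeNat]
  conv_rhs => rw [← Num.to_of_nat k]
  cases (k : Num) with
  | zero => simp [Computability.encodeNum]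
  | pos p => exact key p

theorem le_length_flatMap {α β : Type} {f : α → List β} (hf : ∀ a, 1 ≤ (f a).length) (l : List α) :
    l.length ≤ (l.flatMap f).length := by
  induction l with
  | nil => simp
  | cons a l ih =>
    have := hf a
    simp only [List.length_cons, List.flatMap_cons, List.length_append]
    omega

/-- Every candidate contributes a comma to the encoding. Hence the cap at the input length leaves
candidate names intact and never hides that `m'` is too large. -/
theorem numCandidates_lt (I : Instance) : I.election.numCandidates < I.encode.length := by
  have h := le_length_flatMap (f := encodeNumber) (fun k => by simp [encodeNumber])
    (List.range I.election.numCandidates)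
  simp only [Instance.encode, encodeNumbers, List.length_append, List.length_singleton,
    List.length_range] at h ⊢
  omega

theorem numVoters_lt (I : Instance) : I.election.numVoters < I.encode.length := by
  have h := le_length_flatMap (f := fun v => encodeNumbers (I.election.voteList v))
    (fun v => by simp [encodeNumbers]) (List.finRange I.election.numVoters)
  simp only [List.length_finRange] at h
  simp only [Instance.encode, List.length_append]
  have : 1 ≤ (encodeNumber I.solCandidates).length := by simp [encodeNumber]
  omega

/-- No semicolon separates `m'` and `n'` from the list of candidates, so the three share the first
row. Only the first two numbers can be affected by the cap. -/
theorem rows_eq (I : Instance) :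
    I.rows = (min I.encode.length I.solCandidates :: min I.encode.length I.solVoters ::
        List.range I.election.numCandidates) ::
      (List.finRange I.election.numVoters).map I.election.voteList := by
  have hcap : ∀ l : List ℕ, (∀ k ∈ l, k < I.election.numCandidates) →
      l.map (fun k => min I.encode.length k) = l := by
    intro l hl
    conv_rhs => rw [← List.map_id l]
    refine List.map_congr_left fun k hk => ?_
    have := hl k hk
    have := numCandidates_lt I
    simp only [id_eq]
    omega
  have hparse : I.encode.foldl parseStep ([], [], []) = ([], [],
      ((((List.finRange I.election.numVoters).map I.election.voteList).map fun l =>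
        (l.map fun k => (Computability.encodeNat k).reverse).reverse).reverse ++
      [((I.solCandidates :: I.solVoters :: List.range I.election.numCandidates).map
        fun k => (Computability.encodeNat k).reverse).reverse])) := by
    have h : (List.finRange I.election.numVoters).flatMap
        (fun v => encodeNumbers (I.election.voteList v)) =
        ((List.finRange I.election.numVoters).map I.election.voteList).flatMap encodeNumbers := by
      rw [List.flatMap_map]
    rw [Instance.encode, h, List.foldl_append, List.foldl_append, List.foldl_append,
      foldl_parseStep_number, foldl_parseStep_number, foldl_parseStep_numbers,
      foldl_parseStep_rows]
    simp
  rw [Instance.rows, hparse]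
  simp only [List.map_append, List.map_reverse, List.reverse_append, List.reverse_reverse,
    List.map_map, List.map_cons, List.map_nil,
    comp_def, cappedValue_encodeNat, List.reverse_cons, List.append_assoc, List.reverse_nil,
    List.nil_append, List.cons_append]
  rw [hcap _ fun k hk => by simpa using hk]
  congr 1
  refine List.map_congr_left fun v _ => hcap _ fun k hk => ?_
  simp only [Election.voteList, List.mem_map] at hk
  obtain ⟨i, _, rfl⟩ := hk
  exact (I.election.ranking v i).2

/-! ### The algorithms -/

/-- Is the list `s` a sublist of `l`? -/
def isSub (s l : List ℕ) : Bool :=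
  (l.foldl (fun p x => bif !p.isEmpty && decide (p.headD 0 = x) then p.tail else p) s).isEmpty

/-- The numbers below `n`, in decreasing order. -/
def countdown (n : ℕ) : List ℕ := (fun l : List ℕ => l.length :: l)^[n] []

/-- Extend the members of `S` by a first entry below `n` in all possible ways. -/
def extend (n : ℕ) (S : List (List ℕ)) : List (List ℕ) :=
  S.flatMap fun s => (countdown n).map fun i => i :: s

/-- The lists of length `k` with entries below `n`. -/
def tuples (n k : ℕ) : List (List ℕ) := (extend n)^[k] [[]]

/-- The pair of `⌊n / 2⌋` and `⌈n / 2⌉`. -/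
def halves (n : ℕ) : ℕ × ℕ := (fun p : ℕ × ℕ => (p.2, p.1 + 1))^[n] (0, 0)

/-- Does the list have no duplicates? -/
def nodupTest (l : List ℕ) : Bool :=
  l.all fun x => decide ((l.filter fun y => decide (y = x)).length ≤ 1)

/-- The members of `L` at the positions in `s`. -/
def pick (L : List (List ℕ)) (s : List ℕ) : List (List ℕ) :=
  s.map fun i => (List.tail^[i] L).headD []

/-- All votes of `A` prefer `c` to `d`, and all votes of `B` prefer `d` to `c`. -/
def opposed (A B : List (List ℕ)) (c d : ℕ) : Bool :=
  (A.all fun v => isSub [c, d] v) && B.all fun v => isSub [d, c] v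

/-- The members of `C` to which some member of `T` is preferred in `A` but not in `B`. -/
def nextLevel (p : (List (List ℕ) × List (List ℕ)) × List ℕ) (T : List ℕ) : List ℕ :=
  p.2.filter fun d => T.any fun c => opposed p.1.1 p.1.2 c d

/-- Is there a chain of `k` members of `C` in the relation `opposed A B`? -/
def hasChain (p : (List (List ℕ) × List (List ℕ)) × List ℕ) (k : ℕ) : Bool :=
  decide (k ≤ 0) || !((nextLevel p)^[k - 1] p.2).isEmpty

/-- The required number of candidates. -/
def reqCandidates (R : List (List ℕ)) : ℕ := (R.headD []).headD 0

/-- Half of the required number of voters, rounded up. -/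
def halfVoters (R : List (List ℕ)) : ℕ := (halves ((R.headD []).tail.headD 0)).2

/-- The candidates. -/
def candidates (R : List (List ℕ)) : List ℕ := (R.headD []).tail.tail

/-- Are there enough voters whose votes contain `s` or its reversal as a sublist? -/
def supports (R : List (List ℕ)) (s : List ℕ) : Bool :=
  decide (halfVoters R ≤ (R.tail.filter fun v => isSub s v).length) &&
    (decide (halfVoters R ≤ (R.tail.filter fun v => isSub s.reverse v).length) &&
      decide (halfVoters R + halfVoters R ≤
        (R.tail.filter fun v => isSub s v || isSub s.reverse v).length))

/-- The length of the candidate tuples to be searched. -/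
def candidateDepth (R : List (List ℕ)) : ℕ :=
  bif decide (reqCandidates R ≤ (candidates R).length) then reqCandidates R else 0

/-- The length of the voter tuples to be searched. -/
def voterDepth (R : List (List ℕ)) : ℕ :=
  bif decide (halfVoters R + halfVoters R ≤ R.tail.length) then halfVoters R else 0

/-- The search for a solution among the candidate tuples in `S`. -/
def searchCandidates (R S : List (List ℕ)) : Bool :=
  decide (reqCandidates R ≤ (candidates R).length) && S.any fun s => supports R s

/-- The search for a solution among the pairs of voter tuples in `S`. -/
def searchVoters (R S : List (List ℕ)) : Bool :=
  decide (halfVoters R + halfVoters R ≤ R.tail.length) &&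
    (decide (reqCandidates R ≤ (candidates R).length) &&
      S.any fun s => S.any fun t => nodupTest (s ++ t) &&
        hasChain ((pick R.tail s, pick R.tail t), candidates R) (reqCandidates R))

/-! ### The running time of the algorithms -/

section

variable {α : Type} [Enc α] {μ : α → ℕ}

theorem Bdd.isSub [Sized μ] {s l : α → List ℕ} (hs : Bdd μ s) (hl : Bdd μ l) :
    Bdd μ fun a => isSub (s a) (l a) := by
  refine PolyTime.comp (g := fun p : List ℕ × List ℕ => HiddenSubelections.isSub p.1 p.2) ?_
    (hs.pair hl)
  refine Bdd.isEmpty (Bdd.foldl_of_add (l := fun p : List ℕ × List ℕ => p.2) (i := fun p => p.1)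
    (h := fun _ p x => bif !p.isEmpty && decide (p.headD 0 = x) then p.tail else p)
    (.snd .id) (.fst .id) (.cond (.and (.not (.isEmpty (.snd (.fst .id))))
      (.decide_eq (.headD (.snd (.fst .id)) 0) (.snd .id))) (.tail (.snd (.fst .id)))
      (.snd (.fst .id))) (B := fun _ => 0) (.const 0) fun _ p x => ?_)
  have := esize_le_of_sublist (List.tail_sublist p)
  cases !p.isEmpty && decide (p.headD 0 = x)
  · exact le_rfl
  · exact this

theorem length_countdown (n : ℕ) : (countdown n).length = n := by
  induction n with
  | zero => rfl
  | succ n ih =>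
    rw [countdown, iterate_succ_apply', ← countdown, List.length_cons, ih]

theorem countdown_succ (n : ℕ) : countdown (n + 1) = n :: countdown n := by
  rw [countdown, iterate_succ_apply', ← countdown, length_countdown]

theorem mem_countdown {n i : ℕ} : i ∈ countdown n ↔ i < n := by
  induction n with
  | zero => simp [countdown]
  | succ n ih => rw [countdown_succ, List.mem_cons, ih]; omega

theorem Bdd.countdown {n : α → ℕ} (hn : Bdd μ n) : Bdd μ fun a => countdown (n a) := by
  refine PolyTime.comp (g := HiddenSubelections.countdown) ?_ hn
  refine Bdd.iterate (n := fun n : ℕ => n) (i := fun _ => []) (h := fun _ l => l.length :: l)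
    .id (.const []) (.cons (.length (.snd .id)) (.snd .id))
    (B := fun n => esize n * (esize n + 1) + 1)
    (((PolyBound.refl _).mul ((PolyBound.refl _).add (.const 1))).add (.const 1)) fun n j hj => ?_
  refine (esize_le_mul (B := esize n) fun i hi => ?_).trans (Nat.add_le_add_right
    (Nat.mul_le_mul_right _ ?_) _)
  · have := mem_countdown.mp hi
    simp only [esize_nat]
    omega
  · have := length_countdown j
    rw [HiddenSubelections.countdown] at this
    rw [this, esize_nat]
    omega

theorem polyTime_extend : PolyTime fun p : ℕ × List (List ℕ) => extend p.1 p.2 :=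
  Bdd.flatMap (l := fun p : ℕ × List (List ℕ) => p.2)
    (f := fun p s => (countdown p.1).map fun i => i :: s) (.snd .id)
    (.map (f := fun (q : (ℕ × List (List ℕ)) × List ℕ) i => i :: q.2)
      (.countdown (.fst (.fst .id))) (.cons (.snd .id) (.snd (.fst .id))))

theorem tuples_succ (n k : ℕ) : tuples n (k + 1) = extend n (tuples n k) :=
  iterate_succ_apply' _ _ _

theorem length_tuples (n k : ℕ) : (tuples n k).length = n ^ k := by
  induction k with
  | zero => rfl
  | succ k ih =>
    rw [tuples_succ, extend, List.length_flatMap]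
    simp [length_countdown, ih, pow_succ]

theorem mem_tuples {n k : ℕ} {s : List ℕ} : s ∈ tuples n k ↔ s.length = k ∧ ∀ i ∈ s, i < n := by
  induction k generalizing s with
  | zero => simp +contextual [tuples]
  | succ k ih =>
    rw [tuples_succ, extend, List.mem_flatMap]
    constructor
    · rintro ⟨t, ht, h⟩
      obtain ⟨i, hi, rfl⟩ := List.mem_map.mp h
      obtain ⟨h1, h2⟩ := ih.mp ht
      refine ⟨by simp [h1], fun j hj => ?_⟩
      rcases List.mem_cons.mp hj with rfl | hj
      · exact mem_countdown.mp hi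
      · exact h2 j hj
    · rintro ⟨h1, h2⟩
      cases s with
      | nil => simp at h1
      | cons i t =>
        exact ⟨t, ih.mpr ⟨by simpa using h1, fun j hj => h2 j (List.mem_cons_of_mem _ hj)⟩,
          List.mem_map.mpr ⟨i, mem_countdown.mpr (h2 i List.mem_cons_self), rfl⟩⟩

/-- The measure of the cost of listing the tuples. -/
def tuplesCost (p : ℕ × ℕ) : ℕ := p.1 + p.2 + p.1 ^ p.2

instance : Sized tuplesCost where
  bound := (((PolyBound.refl tuplesCost).mul (.const 4)).add (.const 3)).mono fun p => by
    rw [esize_prod, esize_nat, esize_nat, tuplesCost]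
    omega

theorem bdd_tuples : Bdd tuplesCost fun p : ℕ × ℕ => tuples p.1 p.2 := by
  refine Bdd.iterate (n := fun p : ℕ × ℕ => p.2) (h := fun p S => extend p.1 S)
    (i := fun _ => [[]])
    (B := fun p => (tuplesCost p + 1) * ((esize p * (esize p + 1) + 1) + 1) + 1)
    (.snd .id) (.const [[]])
    (PolyTime.comp (g := fun p : ℕ × List (List ℕ) => extend p.1 p.2) polyTime_extend
      (f := fun p : (ℕ × ℕ) × List (List ℕ) => (p.1.1, p.2)) (.pair (.fst (.fst .id)) (.snd .id)))
    ?_ fun p j hj => ?_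
  · have hs : PolyBound tuplesCost fun p => esize p := Sized.bound
    exact (((PolyBound.refl _).add (.const 1)).mul (((hs.mul (hs.add (.const 1))).add
      (.const 1)).add (.const 1))).add (.const 1)
  · have hl : (HiddenSubelections.tuples p.1 j).length ≤ tuplesCost p + 1 := by
      rw [length_tuples, tuplesCost]
      rcases Nat.eq_zero_or_pos p.1 with h0 | h0
      · rw [h0]
        have : 0 ^ j ≤ 1 := by cases j <;> simp
        exact this.trans (Nat.le_add_left 1 _)
      · have := Nat.pow_le_pow_right h0 hj
        omega
    refine (esize_le_mul (B := esize p * (esize p + 1) + 1) fun s hs => ?_).trans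
      (Nat.add_le_add_right (Nat.mul_le_mul_right _ hl) _)
    obtain ⟨h1, h2⟩ := mem_tuples.mp hs
    refine (esize_le_mul (B := esize p) fun i hi => ?_).trans
      (Nat.add_le_add_right (Nat.mul_le_mul_right _ ?_) _)
    · have := h2 i hi
      simp only [esize_nat, esize_prod]
      omega
    · rw [h1, esize_prod, esize_nat, esize_nat]
      omega

/-- Listing the tuples is polynomial only relative to their number, so the ambient measure has to
dominate `n a ^ k a`. -/
theorem Bdd.tuples [Sized μ] {n k : α → ℕ} (hn : Bdd μ n) (hk : Bdd μ k)
    (h : PolyBound μ fun a => n a ^ k a) : Bdd μ fun a => tuples (n a) (k a) :=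
  Bdd.comp bdd_tuples (hn.pair hk) <| ((hn.size.add hk.size).add h).mono fun a =>
    Nat.add_le_add_right (by simp only [esize_nat]; omega) _

theorem halves_eq (n : ℕ) : halves n = (n / 2, (n + 1) / 2) := by
  induction n with
  | zero => rfl
  | succ n ih =>
    rw [halves, iterate_succ_apply', ← halves, ih]
    rw [Prod.mk.injEq]
    omega

theorem Bdd.halves {n : α → ℕ} (hn : Bdd μ n) : Bdd μ fun a => halves (n a) := by
  refine PolyTime.comp (g := HiddenSubelections.halves) ?_ hn
  refine Bdd.iterate (n := fun n : ℕ => n) (i := fun _ => (0, 0)) (h := fun _ p => (p.2, p.1 + 1))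
    .id (.const (0, 0)) (.pair (.snd (.snd .id)) (.succ (.fst (.snd .id))))
    (B := fun n => 2 * esize n + 5) (((PolyBound.const 2).mul (.refl _)).add (.const 5))
    fun n j hj => ?_
  have := halves_eq j
  rw [HiddenSubelections.halves] at this
  rw [this, esize_prod, esize_nat, esize_nat, esize_nat]
  dsimp only
  omega

theorem Bdd.nodupTest {l : α → List ℕ} (hl : Bdd μ l) : Bdd μ fun a => nodupTest (l a) := by
  refine PolyTime.comp (g := HiddenSubelections.nodupTest) ?_ hl
  exact Bdd.all (l := fun l : List ℕ => l)
    (f := fun l x => decide ((l.filter fun y => decide (y = x)).length ≤ 1)) .id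
    (.decide_le (.length (.filter (f := fun (p : List ℕ × ℕ) y => decide (y = p.2)) (.fst .id)
      (.decide_eq (.snd .id) (.snd (.fst .id))))) (.const 1))

theorem iterate_tail_suffix {β : Type} (l : List β) (j : ℕ) : List.tail^[j] l <:+ l := by
  induction j with
  | zero => exact List.suffix_refl _
  | succ j ih => rw [iterate_succ_apply']; exact (List.tail_suffix _).trans ih

theorem Bdd.drop [Sized μ] {β : Type} [Enc β] {n : α → ℕ} {l : α → List β} (hn : Bdd μ n) (hl : Bdd μ l) :
    Bdd μ fun a => List.tail^[n a] (l a) :=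
  Bdd.iterate (h := fun _ l => l.tail) hn hl (.tail (.snd .id)) hl.size
    fun a j _ => esize_le_of_sublist (iterate_tail_suffix (l a) j).sublist

theorem Bdd.pick [Sized μ] {L : α → List (List ℕ)} {s : α → List ℕ} (hL : Bdd μ L) (hs : Bdd μ s) :
    Bdd μ fun a => pick (L a) (s a) := by
  refine PolyTime.comp (g := fun p : List (List ℕ) × List ℕ => HiddenSubelections.pick p.1 p.2) ?_
    (hL.pair hs)
  exact Bdd.map (l := fun p : List (List ℕ) × List ℕ => p.2)
    (f := fun p i => (List.tail^[i] p.1).headD []) (.snd .id)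
    (.headD (.drop (.snd .id) (.fst (.fst .id))) [])

theorem polyTime_opposed : PolyTime fun p : (List (List ℕ) × List (List ℕ)) × (ℕ × ℕ) =>
    opposed p.1.1 p.1.2 p.2.1 p.2.2 := by
  have h1 : PolyTime fun p : (List (List ℕ) × List (List ℕ)) × (ℕ × ℕ) =>
      p.1.1.all fun v => isSub [p.2.1, p.2.2] v :=
    Bdd.all (f := fun (p : (List (List ℕ) × List (List ℕ)) × (ℕ × ℕ)) v =>
      isSub [p.2.1, p.2.2] v) (.fst (.fst .id))
      (.isSub (.cons (.fst (.snd (.fst .id))) (.cons (.snd (.snd (.fst .id))) (.const [])))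
        (.snd .id))
  have h2 : PolyTime fun p : (List (List ℕ) × List (List ℕ)) × (ℕ × ℕ) =>
      p.1.2.all fun v => isSub [p.2.2, p.2.1] v :=
    Bdd.all (f := fun (p : (List (List ℕ) × List (List ℕ)) × (ℕ × ℕ)) v =>
      isSub [p.2.2, p.2.1] v) (.snd (.fst .id))
      (.isSub (.cons (.snd (.snd (.fst .id))) (.cons (.fst (.snd (.fst .id))) (.const [])))
        (.snd .id))
  exact h1.and h2

theorem polyTime_nextLevel : PolyTime fun p : ((List (List ℕ) × List (List ℕ)) × List ℕ) × List ℕ =>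
    nextLevel p.1 p.2 := by
  refine Bdd.filter (l := fun p : ((List (List ℕ) × List (List ℕ)) × List ℕ) × List ℕ => p.1.2)
    (f := fun p d => p.2.any fun c => opposed p.1.1.1 p.1.1.2 c d) (.snd (.fst .id)) ?_
  refine Bdd.any
    (l := fun q : (((List (List ℕ) × List (List ℕ)) × List ℕ) × List ℕ) × ℕ => q.1.2)
    (f := fun q c => opposed q.1.1.1.1 q.1.1.1.2 c q.2) (.snd (.fst .id)) ?_
  exact PolyTime.comp (g := fun p : (List (List ℕ) × List (List ℕ)) × (ℕ × ℕ) =>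
    opposed p.1.1 p.1.2 p.2.1 p.2.2) polyTime_opposed
    (f := fun q : ((((List (List ℕ) × List (List ℕ)) × List ℕ) × List ℕ) × ℕ) × ℕ =>
      (q.1.1.1.1, (q.2, q.1.2)))
    (.pair (.fst (.fst (.fst (.fst .id)))) (.pair (.snd .id) (.snd (.fst .id))))

/-- Levels never outgrow the list of candidates, which is the accumulator bound for `Bdd.hasChain`.
-/
theorem iterate_nextLevel_sublist (p : (List (List ℕ) × List (List ℕ)) × List ℕ) (j : ℕ) :
    ((nextLevel p)^[j] p.2).Sublist p.2 := by
  cases j with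
  | zero => exact List.Sublist.refl _
  | succ j => rw [iterate_succ_apply']; exact List.filter_sublist

theorem Bdd.hasChain [Sized μ] {p : α → (List (List ℕ) × List (List ℕ)) × List ℕ} {k : α → ℕ}
    (hp : Bdd μ p) (hk : Bdd μ k) : Bdd μ fun a => hasChain (p a) (k a) := by
  refine PolyTime.comp (g := fun q : ((List (List ℕ) × List (List ℕ)) × List ℕ) × ℕ =>
    HiddenSubelections.hasChain q.1 q.2) ?_ (hp.pair hk)
  refine Bdd.or (.decide_le (.snd .id) (.const 0)) (.not (.isEmpty ?_))
  exact Bdd.iterate (n := fun q : ((List (List ℕ) × List (List ℕ)) × List ℕ) × ℕ => q.2 - 1)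
    (i := fun q => q.1.2) (h := fun q T => nextLevel q.1 T) (.pred (.snd .id)) (.snd (.fst .id))
    (PolyTime.comp (g := fun p : ((List (List ℕ) × List (List ℕ)) × List ℕ) × List ℕ =>
      nextLevel p.1 p.2) polyTime_nextLevel
      (f := fun q : (((List (List ℕ) × List (List ℕ)) × List ℕ) × ℕ) × List ℕ => (q.1.1, q.2))
      (.pair (.fst (.fst .id)) (.snd .id)))
    (B := fun q => esize q) (.refl _) fun q j _ =>
      (esize_le_of_sublist (iterate_nextLevel_sublist q.1 j)).trans (by
        rw [esize_prod, esize_prod]; omega)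

variable {R S : α → List (List ℕ)}

theorem Bdd.reqCandidates (hR : Bdd μ R) : Bdd μ fun a => reqCandidates (R a) :=
  .headD (.headD hR []) 0

theorem Bdd.halfVoters (hR : Bdd μ R) : Bdd μ fun a => halfVoters (R a) :=
  .snd (.halves (.headD (.tail (.headD hR [])) 0))

theorem Bdd.candidates (hR : Bdd μ R) : Bdd μ fun a => candidates (R a) :=
  .tail (.tail (.headD hR []))

theorem Bdd.candidateDepth [Sized μ] (hR : Bdd μ R) : Bdd μ fun a => candidateDepth (R a) :=
  .cond (.decide_le hR.reqCandidates hR.candidates.length) hR.reqCandidates (.const 0)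

theorem Bdd.voterDepth [Sized μ] (hR : Bdd μ R) : Bdd μ fun a => voterDepth (R a) :=
  .cond (.decide_le (hR.halfVoters.add hR.halfVoters) hR.tail.length) hR.halfVoters (.const 0)

theorem Bdd.supports [Sized μ] {s : α → List ℕ} (hR : Bdd μ R) (hs : Bdd μ s) :
    Bdd μ fun a => supports (R a) (s a) := by
  refine PolyTime.comp (g := fun p : List (List ℕ) × List ℕ =>
    HiddenSubelections.supports p.1 p.2) ?_ (hR.pair hs)
  have h : PolyTime fun p : List (List ℕ) × List ℕ => HiddenSubelections.halfVoters p.1 :=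
    .halfVoters (.fst .id)
  refine .and (.decide_le h (.length ?_)) (.and (.decide_le h (.length ?_))
    (.decide_le (h.add h) (.length ?_)))
  · exact Bdd.filter (f := fun (p : List (List ℕ) × List ℕ) v => HiddenSubelections.isSub p.2 v)
      (.tail (.fst .id)) (.isSub (.snd (.fst .id)) (.snd .id))
  · exact Bdd.filter (f := fun (p : List (List ℕ) × List ℕ) v =>
      HiddenSubelections.isSub p.2.reverse v)
      (.tail (.fst .id)) (.isSub (.reverse (.snd (.fst .id))) (.snd .id))
  · exact Bdd.filter (f := fun (p : List (List ℕ) × List ℕ) v =>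
      HiddenSubelections.isSub p.2 v || HiddenSubelections.isSub p.2.reverse v)
      (.tail (.fst .id)) (.or (.isSub (.snd (.fst .id)) (.snd .id))
        (.isSub (.reverse (.snd (.fst .id))) (.snd .id)))

theorem Bdd.searchCandidates [Sized μ] (hR : Bdd μ R) (hS : Bdd μ S) :
    Bdd μ fun a => searchCandidates (R a) (S a) := by
  refine PolyTime.comp (g := fun p : List (List ℕ) × List (List ℕ) =>
    HiddenSubelections.searchCandidates p.1 p.2) ?_ (hR.pair hS)
  exact Bdd.and (.decide_le (.reqCandidates (.fst .id)) (.length (.candidates (.fst .id))))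
    (.any (f := fun (p : List (List ℕ) × List (List ℕ)) s => HiddenSubelections.supports p.1 s)
      (.snd .id) (.supports (.fst (.fst .id)) (.snd .id)))

theorem polyTime_testPair : PolyTime fun q : (List (List ℕ) × List ℕ) × List ℕ =>
    nodupTest (q.1.2 ++ q.2) && hasChain
      ((pick q.1.1.tail q.1.2, pick q.1.1.tail q.2), candidates q.1.1) (reqCandidates q.1.1) := by
  have hR : PolyTime fun q : (List (List ℕ) × List ℕ) × List ℕ => q.1.1 := .fst (.fst .id)
  have hs : PolyTime fun q : (List (List ℕ) × List ℕ) × List ℕ => q.1.2 := .snd (.fst .id)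
  have ht : PolyTime fun q : (List (List ℕ) × List ℕ) × List ℕ => q.2 := .snd .id
  exact (hs.append ht).nodupTest.and
    ((((hR.tail.pick hs).pair (hR.tail.pick ht)).pair hR.candidates).hasChain hR.reqCandidates)

theorem polyTime_searchVoters :
    PolyTime fun p : List (List ℕ) × List (List ℕ) => searchVoters p.1 p.2 := by
  have h1 : PolyTime fun q : ((List (List ℕ) × List (List ℕ)) × List ℕ) × List ℕ =>
      nodupTest (q.1.2 ++ q.2) && hasChain
        ((pick q.1.1.1.tail q.1.2, pick q.1.1.1.tail q.2), candidates q.1.1.1)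
          (reqCandidates q.1.1.1) := PolyTime.comp polyTime_testPair
    (f := fun q : ((List (List ℕ) × List (List ℕ)) × List ℕ) × List ℕ => ((q.1.1.1, q.1.2), q.2))
    (.pair (.pair (.fst (.fst (.fst .id))) (.snd (.fst .id))) (.snd .id))
  have h2 := Bdd.any (μ := fun q => esize q) (l := fun q : (List (List ℕ) × List (List ℕ)) × List ℕ => q.1.2)
    (f := fun q t => nodupTest (q.2 ++ t) && hasChain
      ((pick q.1.1.tail q.2, pick q.1.1.tail t), candidates q.1.1) (reqCandidates q.1.1))
    (.snd (.fst .id)) h1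
  have h3 := Bdd.any (μ := fun p => esize p) (l := fun p : List (List ℕ) × List (List ℕ) => p.2)
    (f := fun p s => p.2.any fun t => nodupTest (s ++ t) && hasChain
      ((pick p.1.tail s, pick p.1.tail t), candidates p.1) (reqCandidates p.1)) (.snd .id) h2
  have hR : PolyTime fun p : List (List ℕ) × List (List ℕ) => p.1 := .fst .id
  exact ((hR.halfVoters.add hR.halfVoters).decide_le hR.tail.length).and
    ((hR.reqCandidates.decide_le hR.candidates.length).and h3)

theorem Bdd.searchVoters [Sized μ] (hR : Bdd μ R) (hS : Bdd μ S) :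
    Bdd μ fun a => searchVoters (R a) (S a) :=
  PolyTime.comp (g := fun p : List (List ℕ) × List (List ℕ) =>
    HiddenSubelections.searchVoters p.1 p.2) (f := fun a => (R a, S a)) polyTime_searchVoters
    (hR.pair hS)

end

/-! ### Correctness of the tests -/

theorem isSub_iff {s l : List ℕ} : isSub s l = true ↔ s.Sublist l := by
  unfold isSub
  induction l generalizing s with
  | nil => simp
  | cons x l ih =>
    rw [List.foldl_cons]
    cases s with
    | nil => rw [List.isEmpty_nil]; simpa using ih (s := [])
    | cons y s =>
      rw [List.cons_sublist_cons']
      by_cases h : y = x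
      · subst h
        simp only [List.isEmpty_cons, Bool.not_false, Bool.true_and, List.headD_cons, decide_true,
          cond_true, List.tail_cons, ih, true_and]
        -- Greedy matching loses nothing: an embedding that skips `x` still embeds the tail `s` in
        -- `l`.
        exact ⟨.inr, fun h => h.elim (fun h => (List.sublist_cons_self _ _).trans h) id⟩
      · simp only [List.isEmpty_cons, Bool.not_false, Bool.true_and, List.headD_cons, h,
          decide_false, cond_false, ih, false_and, or_false]

theorem nodupTest_iff {l : List ℕ} : nodupTest l = true ↔ l.Nodup := by
  have h : ∀ x, (l.filter fun y => decide (y = x)).length = l.count x := by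
    intro x
    rw [List.count_eq_length_filter]
    congr 1
  rw [List.nodup_iff_count_le_one, nodupTest, List.all_eq_true]
  simp only [decide_eq_true_eq, h]
  refine ⟨fun H a => ?_, fun H x _ => H x⟩
  by_cases ha : a ∈ l
  · exact H a ha
  · rw [List.count_eq_zero_of_not_mem ha]
    exact Nat.zero_le _

/-- Level `j` consists of the last members of chains with `j + 1` members. The chain is listed from
its end, so that a step prepends an entry. -/
theorem mem_iterate_nextLevel {p : (List (List ℕ) × List (List ℕ)) × List ℕ} {j d : ℕ} :
    d ∈ (nextLevel p)^[j] p.2 ↔ ∃ l : List ℕ, l.length = j ∧ (∀ x ∈ d :: l, x ∈ p.2) ∧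
      (d :: l).IsChain fun a b => opposed p.1.1 p.1.2 b a = true := by
  induction j generalizing d with
  | zero =>
    constructor
    · exact fun h => ⟨[], rfl, by simpa using h, by simp⟩
    · rintro ⟨l, -, h, -⟩
      exact h d List.mem_cons_self
  | succ j ih =>
    rw [iterate_succ_apply', nextLevel, List.mem_filter, List.any_eq_true]
    constructor
    · rintro ⟨hd, c, hc, hcd⟩
      obtain ⟨l, h1, h2, h3⟩ := ih.mp hc
      refine ⟨c :: l, by simp [h1], fun x hx => ?_, List.isChain_cons_cons.mpr ⟨hcd, h3⟩⟩
      rcases List.mem_cons.mp hx with rfl | hx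
      · exact hd
      · exact h2 x hx
    · rintro ⟨l, h1, h2, h3⟩
      cases l with
      | nil => simp at h1
      | cons c l =>
        obtain ⟨hcd, h3⟩ := List.isChain_cons_cons.mp h3
        exact ⟨h2 d List.mem_cons_self, c, ih.mpr ⟨l, by simpa using h1,
          fun x hx => h2 x (List.mem_cons_of_mem _ hx), h3⟩, hcd⟩

theorem hasChain_iff {p : (List (List ℕ) × List (List ℕ)) × List ℕ} {k : ℕ} :
    hasChain p k = true ↔ ∃ l : List ℕ, l.length = k ∧ (∀ x ∈ l, x ∈ p.2) ∧
      l.IsChain fun a b => opposed p.1.1 p.1.2 b a = true := by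
  rw [hasChain, Bool.or_eq_true, decide_eq_true_eq, Bool.not_eq_true', List.isEmpty_eq_false_iff_exists_mem]
  simp only [mem_iterate_nextLevel]
  constructor
  · rintro (h | ⟨d, l, h1, h2, h3⟩)
    -- For `k = 0` the empty chain suffices, whereas level `k - 1 = 0` would demand a candidate.
    · exact ⟨[], by simp; omega, by simp, by simp⟩
    · rcases Nat.eq_zero_or_pos k with h0 | h0
      · exact ⟨[], by simp [h0], by simp, by simp⟩
      · exact ⟨d :: l, by rw [List.length_cons]; omega, h2, h3⟩
  · rintro ⟨l, h1, h2, h3⟩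
    cases l with
    | nil => exact .inl (by simp at h1; omega)
    | cons d l => exact .inr ⟨d, l, by rw [List.length_cons] at h1; omega, h2, h3⟩

/-! ### Antagonisms -/

namespace Election

variable (E : Election)

theorem prefers_asymm {E : Election} {v c d} (h : E.Prefers v c d) : ¬ E.Prefers v d c :=
  lt_asymm h

theorem prefers_irrefl {E : Election} {v c} : ¬ E.Prefers v c c := lt_irrefl _

theorem prefers_trans {E : Election} {v a b c} (h : E.Prefers v a b) (h' : E.Prefers v b c) :
    E.Prefers v a c := lt_trans h h'

/-- Any two voters from `V₁` and `V₂` rank all pairs of candidates from `C` in opposite ways. -/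
def Opposite (C : Finset (Fin E.numCandidates)) (V₁ V₂ : Finset (Fin E.numVoters)) : Prop :=
  ∀ v₁ ∈ V₁, ∀ v₂ ∈ V₂, ∀ c ∈ C, ∀ c' ∈ C, E.Prefers v₁ c c' ↔ E.Prefers v₂ c' c

/-- The list `s` lists candidates in the order of the voters of `V₁` and against the order of the
voters of `V₂`. -/
def Sorts (s : List (Fin E.numCandidates)) (V₁ V₂ : Finset (Fin E.numVoters)) : Prop :=
  (∀ v ∈ V₁, s.Pairwise (E.Prefers v)) ∧ ∀ v ∈ V₂, s.Pairwise fun a b => E.Prefers v b a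

/-- The vote of `v` as a list of candidates. -/
def vote (v : Fin E.numVoters) : List (Fin E.numCandidates) :=
  (List.finRange E.numCandidates).map (E.ranking v)

variable {E}

theorem map_val_vote (v : Fin E.numVoters) : (E.vote v).map Fin.val = E.voteList v := by
  rw [vote, List.map_map]
  rfl

theorem pairwise_vote (v : Fin E.numVoters) : (E.vote v).Pairwise (E.Prefers v) := by
  rw [vote, List.pairwise_map]
  simpa [Prefers] using List.pairwise_lt_finRange E.numCandidates

theorem mem_vote (v : Fin E.numVoters) (c : Fin E.numCandidates) : c ∈ E.vote v :=
  List.mem_map.mpr ⟨(E.ranking v).symm c, List.mem_finRange _, by simp⟩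

theorem nodup_of_pairwise {v : Fin E.numVoters} {s : List (Fin E.numCandidates)}
    (h : s.Pairwise (E.Prefers v)) : s.Nodup :=
  List.Pairwise.imp (S := (· ≠ ·)) (fun {a b} hab (e : a = b) => prefers_irrefl (e ▸ hab)) h

/-- A list sorted by a strict order has no repetitions, so it is a subpermutation of the full vote;
as both are sorted, it is a sublist. -/
theorem sublist_vote_iff {v : Fin E.numVoters} {s : List (Fin E.numCandidates)} :
    s.Sublist (E.vote v) ↔ s.Pairwise (E.Prefers v) := by
  refine ⟨fun h => (pairwise_vote v).sublist h, fun h => ?_⟩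
  have : Std.Antisymm (E.Prefers v) := ⟨fun _ _ h h' => absurd h' (prefers_asymm h)⟩
  exact List.sublist_of_subperm_of_pairwise
    ((nodup_of_pairwise h).subperm fun c _ => mem_vote v c) h (pairwise_vote v)

theorem isSub_voteList {v : Fin E.numVoters} {s : List (Fin E.numCandidates)} :
    isSub (s.map Fin.val) (E.voteList v) = true ↔ s.Pairwise (E.Prefers v) := by
  rw [isSub_iff, ← sublist_vote_iff, ← map_val_vote]
  refine ⟨fun h => ?_, fun h => h.map _⟩
  obtain ⟨t, ht, e⟩ := List.sublist_map_iff.mp h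
  rwa [List.map_injective_iff.mpr Fin.val_injective e]

theorem isSub_reverse_voteList {v : Fin E.numVoters} {s : List (Fin E.numCandidates)} :
    isSub (s.map Fin.val).reverse (E.voteList v) = true ↔
      s.Pairwise fun a b => E.Prefers v b a := by
  rw [← List.map_reverse, isSub_voteList, List.pairwise_reverse]

theorem Sorts.opposite {s : List (Fin E.numCandidates)} {V₁ V₂ : Finset (Fin E.numVoters)}
    (h : E.Sorts s V₁ V₂) : E.Opposite s.toFinset V₁ V₂ := by
  intro v₁ h₁ v₂ h₂ c hc c' hc'
  -- Symmetrizing the claim lets it pass from pairs in list order to all pairs.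
  let S : Fin E.numCandidates → Fin E.numCandidates → Prop := fun a b =>
    (E.Prefers v₁ a b ↔ E.Prefers v₂ b a) ∧ (E.Prefers v₁ b a ↔ E.Prefers v₂ a b)
  have : Std.Symm S := ⟨fun _ _ h => ⟨h.2, h.1⟩⟩
  have hp : s.Pairwise S := ((h.1 v₁ h₁).and (h.2 v₂ h₂)).imp fun ⟨h, h'⟩ =>
    ⟨iff_of_true h h', iff_of_false (prefers_asymm h) (prefers_asymm h')⟩
  exact (hp.forall_of_forall (fun x _ => ⟨iff_of_false prefers_irrefl prefers_irrefl,
    iff_of_false prefers_irrefl prefers_irrefl⟩) (List.mem_toFinset.mp hc)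
    (List.mem_toFinset.mp hc')).1

/-- The list is the vote of some `v₁ ∈ V₁` restricted to `C`. Any other voter of `V₁` agrees with
`v₁` because both are opposite to `v₂`; this is where both sides must be nonempty. -/
theorem Opposite.exists_sorts {C : Finset (Fin E.numCandidates)}
    {V₁ V₂ : Finset (Fin E.numVoters)} (h : E.Opposite C V₁ V₂) (h₁ : V₁.Nonempty)
    (h₂ : V₂.Nonempty) : ∃ s, E.Sorts s V₁ V₂ ∧ s.length = C.card := by
  obtain ⟨v₁, h₁⟩ := h₁
  obtain ⟨v₂, h₂⟩ := h₂
  have hs := (pairwise_vote v₁).filter fun c => decide (c ∈ C)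
  refine ⟨(E.vote v₁).filter fun c => decide (c ∈ C), ⟨fun v hv => ?_, fun v hv => ?_⟩, ?_⟩
  · refine hs.imp_of_mem fun {a b} ha hb hab => ?_
    simp only [List.mem_filter, decide_eq_true_eq] at ha hb
    rwa [h v hv v₂ h₂ a ha.2 b hb.2, ← h v₁ h₁ v₂ h₂ a ha.2 b hb.2]
  · refine hs.imp_of_mem fun {a b} ha hb hab => ?_
    simp only [List.mem_filter, decide_eq_true_eq] at ha hb
    rwa [← h v₁ h₁ v hv a ha.2 b hb.2]
  · rw [← List.toFinset_card_of_nodup (nodup_of_pairwise hs)]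
    congr 1
    ext c
    simp [mem_vote]

end Election

/-! ### Solutions of exact size, and sorted lists in place of candidate sets. -/

/-- Antagonism survives passing to subsets of `C'`, and of `V₁` and `V₂` of equal size. As `|V'| =
2|V₁|`, the demand `|V'| ≥ n'` means `|V₁| ≥ ⌈n'/2⌉`. -/
theorem hiddenAN_iff (I : Instance) : HiddenAN I ↔
    ∃ C V₁ V₂, I.election.Opposite C V₁ V₂ ∧ C.card = I.solCandidates ∧ Disjoint V₁ V₂ ∧
      V₁.card = (I.solVoters + 1) / 2 ∧ V₂.card = (I.solVoters + 1) / 2 := by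
  constructor
  · rintro ⟨C, V, ⟨-, V₁, V₂, rfl, hd, hc, hop⟩, hC, hV⟩
    rw [Finset.card_union_of_disjoint hd] at hV
    obtain ⟨D, hD, hD'⟩ := Finset.exists_subset_card_eq hC
    obtain ⟨W₁, h₁, h₁'⟩ := Finset.exists_subset_card_eq
      (show (I.solVoters + 1) / 2 ≤ V₁.card by omega)
    obtain ⟨W₂, h₂, h₂'⟩ := Finset.exists_subset_card_eq
      (show (I.solVoters + 1) / 2 ≤ V₂.card by omega)
    exact ⟨D, W₁, W₂, fun v hv w hw c hc d hd => hop v (h₁ hv) w (h₂ hw) c (hD hc) d (hD hd), hD',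
      Finset.disjoint_of_subset_left h₁ (Finset.disjoint_of_subset_right h₂ hd), h₁', h₂'⟩
  · rintro ⟨C, V₁, V₂, hop, hC, hd, h₁, h₂⟩
    have hc := Finset.card_union_of_disjoint hd
    exact ⟨C, V₁ ∪ V₂, ⟨⟨V₁.card, by omega⟩, V₁, V₂, rfl, hd, by omega, hop⟩, hC.ge, by omega⟩

/-- If no voters are required, then it suffices to have enough candidates. -/
theorem hiddenAN_iff_of_eq_zero {I : Instance} (h : (I.solVoters + 1) / 2 = 0) :
    HiddenAN I ↔ I.solCandidates ≤ I.election.numCandidates := by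
  rw [hiddenAN_iff]
  constructor
  · rintro ⟨C, -, -, -, hC, -⟩
    rw [← hC]
    simpa using Finset.card_le_univ C
  · intro h'
    obtain ⟨C, -, hC⟩ := Finset.exists_subset_card_eq
      (s := (Finset.univ : Finset (Fin I.election.numCandidates))) (n := I.solCandidates)
      (by simpa using h')
    exact ⟨C, ∅, ∅, fun v hv => by simp at hv, hC, by simp, by simp [h], by simp [h]⟩

theorem hiddenAN_iff_sorts {I : Instance} (h : 0 < (I.solVoters + 1) / 2) : HiddenAN I ↔
    ∃ s V₁ V₂, I.election.Sorts s V₁ V₂ ∧ s.length = I.solCandidates ∧ Disjoint V₁ V₂ ∧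
      V₁.card = (I.solVoters + 1) / 2 ∧ V₂.card = (I.solVoters + 1) / 2 := by
  rw [hiddenAN_iff]
  constructor
  · rintro ⟨C, V₁, V₂, hop, hC, hd, h₁, h₂⟩
    obtain ⟨s, hs, hs'⟩ := hop.exists_sorts (Finset.card_pos.mp (h₁ ▸ h))
      (Finset.card_pos.mp (h₂ ▸ h))
    exact ⟨s, V₁, V₂, hs, hs'.trans hC, hd, h₁, h₂⟩
  · rintro ⟨s, V₁, V₂, hs, hC, hd, h₁, h₂⟩
    obtain ⟨v, hv⟩ := Finset.card_pos.mp (h₁ ▸ h)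
    exact ⟨s.toFinset, V₁, V₂, hs.opposite, by
      rw [List.toFinset_card_of_nodup (Election.nodup_of_pairwise (hs.1 v hv)), hC], hd, h₁, h₂⟩

/-- A Hall-type condition. Elements of `A \ B` are useless for `W`, so `V` uses them first. -/
theorem exists_disjoint_subsets_iff {α : Type} [DecidableEq α] {A B : Finset α} {k : ℕ} :
    (∃ V W, V ⊆ A ∧ W ⊆ B ∧ Disjoint V W ∧ V.card = k ∧ W.card = k) ↔
      k ≤ A.card ∧ k ≤ B.card ∧ k + k ≤ (A ∪ B).card := by
  constructor
  · rintro ⟨V, W, hV, hW, hd, rfl, h⟩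
    refine ⟨Finset.card_le_card hV, h ▸ Finset.card_le_card hW, ?_⟩
    have := Finset.card_le_card (Finset.union_subset_union hV hW)
    rw [Finset.card_union_of_disjoint hd] at this
    omega
  · rintro ⟨hA, hB, hAB⟩
    rcases le_total k (A \ B).card with h | h
    · obtain ⟨V, hV, hk⟩ := Finset.exists_subset_card_eq h
      obtain ⟨W, hW, hk'⟩ := Finset.exists_subset_card_eq hB
      exact ⟨V, W, hV.trans Finset.sdiff_subset, hW, Finset.disjoint_of_subset_left hV
        (Finset.disjoint_of_subset_right hW Finset.sdiff_disjoint), hk, hk'⟩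
    -- Here `V` exhausts `A \ B`, so what remains of `A ∪ B` lies in `B` and has at least `k`
    -- elements.
    · obtain ⟨V, hV, hV', hk⟩ := Finset.exists_subsuperset_card_eq Finset.sdiff_subset h hA
      have hs : (A ∪ B) \ V ⊆ B \ V := by
        intro x hx
        simp only [Finset.mem_sdiff, Finset.mem_union] at hx ⊢
        refine ⟨by_contra fun hB => hx.2 (hV (Finset.mem_sdiff.mpr ⟨?_, hB⟩)), hx.2⟩
        exact hx.1.resolve_right hB
      have h1 := Finset.card_le_card hs
      have h2 := Finset.le_card_sdiff V (A ∪ B)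
      obtain ⟨W, hW, hk'⟩ := Finset.exists_subset_card_eq (show k ≤ (B \ V).card by omega)
      exact ⟨V, W, hV', hW.trans Finset.sdiff_subset,
        Finset.disjoint_of_subset_right hW Finset.disjoint_sdiff, hk, hk'⟩

/-! ### Correctness of both searches on the parsed instance. -/

section

variable (I : Instance)

theorem candidates_rows : candidates I.rows = List.range I.election.numCandidates := by
  rw [rows_eq]
  rfl

theorem tail_rows : I.rows.tail =
    (List.finRange I.election.numVoters).map I.election.voteList := by
  rw [rows_eq]
  rfl

theorem length_candidates_rows : (candidates I.rows).length = I.election.numCandidates := by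
  rw [candidates_rows, List.length_range]

theorem length_tail_rows : I.rows.tail.length = I.election.numVoters := by
  rw [tail_rows, List.length_map, List.length_finRange]

theorem reqCandidates_rows : reqCandidates I.rows = min I.encode.length I.solCandidates := by
  rw [rows_eq]
  rfl

theorem halfVoters_rows : halfVoters I.rows = (min I.encode.length I.solVoters + 1) / 2 := by
  rw [rows_eq, halfVoters, halves_eq]
  rfl

theorem reqCandidates_le_iff : reqCandidates I.rows ≤ I.election.numCandidates ↔
    I.solCandidates ≤ I.election.numCandidates := by
  have := numCandidates_lt I
  rw [reqCandidates_rows]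
  omega

variable {I}

theorem reqCandidates_eq (h : I.solCandidates ≤ I.election.numCandidates) :
    reqCandidates I.rows = I.solCandidates := by
  have := numCandidates_lt I
  rw [reqCandidates_rows]
  omega

/-- When the cap on `n'` takes effect, both left-hand sides exceed the number of voters, hence `k`.
-/
theorem add_halfVoters_le_iff {k : ℕ} (hk : k ≤ I.election.numVoters) :
    halfVoters I.rows + halfVoters I.rows ≤ k ↔
      (I.solVoters + 1) / 2 + (I.solVoters + 1) / 2 ≤ k := by
  have := numVoters_lt I
  rw [halfVoters_rows]
  omega

theorem halfVoters_eq
    (h : (I.solVoters + 1) / 2 + (I.solVoters + 1) / 2 ≤ I.election.numVoters) :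
    halfVoters I.rows = (I.solVoters + 1) / 2 := by
  have := numVoters_lt I
  rw [halfVoters_rows]
  omega

theorem length_filter_tail_rows (p : List ℕ → Bool) : (I.rows.tail.filter p).length =
    (Finset.univ.filter fun v => p (I.election.voteList v) = true).card := by
  have h : (Finset.univ.filter fun v => p (I.election.voteList v) = true) =
      ((List.finRange I.election.numVoters).filter fun v => p (I.election.voteList v)).toFinset := by
    ext v
    simp
  rw [h, List.toFinset_card_of_nodup ((List.nodup_finRange _).filter _), tail_rows,
    List.filter_map, List.length_map]
  rfl

/-- For lists with at most one candidate every voter ranks both along and against `s`. Counting the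
two sides separately is therefore not enough, and the union is counted as well. -/
theorem supports_iff {s : List (Fin I.election.numCandidates)} :
    supports I.rows (s.map Fin.val) = true ↔ ∃ V₁ V₂, I.election.Sorts s V₁ V₂ ∧ Disjoint V₁ V₂ ∧
      V₁.card = (I.solVoters + 1) / 2 ∧ V₂.card = (I.solVoters + 1) / 2 := by
  classical
  set A := Finset.univ.filter fun v => s.Pairwise (I.election.Prefers v) with hA
  set B := Finset.univ.filter fun v => s.Pairwise fun a b => I.election.Prefers v b a with hB
  have hAB : (A ∪ B).card ≤ I.election.numVoters := by simpa using Finset.card_le_univ (A ∪ B)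
  have h := exists_disjoint_subsets_iff (A := A) (B := B) (k := (I.solVoters + 1) / 2)
  have h1 := Finset.card_le_card (Finset.subset_union_left (s₁ := A) (s₂ := B))
  have h2 := Finset.card_le_card (Finset.subset_union_right (s₁ := A) (s₂ := B))
  have h3 := add_halfVoters_le_iff hAB
  have h4 := halfVoters_eq (I := I)
  rw [supports]
  simp only [Bool.and_eq_true, decide_eq_true_eq, length_filter_tail_rows, Bool.or_eq_true,
    Election.isSub_voteList, Election.isSub_reverse_voteList]
  rw [Finset.filter_or, ← hA, ← hB]
  trans (I.solVoters + 1) / 2 ≤ A.card ∧ (I.solVoters + 1) / 2 ≤ B.card ∧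
    (I.solVoters + 1) / 2 + (I.solVoters + 1) / 2 ≤ (A ∪ B).card
  · constructor
    · rintro ⟨a, b, c⟩
      have e := h4 ((h3.mp c).trans hAB)
      exact ⟨e ▸ a, e ▸ b, h3.mp c⟩
    · rintro ⟨a, b, c⟩
      have e := h4 (c.trans hAB)
      exact ⟨e ▸ a, e ▸ b, h3.mpr c⟩
  · rw [← h]
    refine exists_congr fun V₁ => exists_congr fun V₂ => ?_
    have hs : I.election.Sorts s V₁ V₂ ↔ V₁ ⊆ A ∧ V₂ ⊆ B := by
      simp [Election.Sorts, hA, hB, Finset.subset_iff]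
    rw [hs, and_assoc]

theorem searchCandidates_iff : searchCandidates I.rows
    (tuples (candidates I.rows).length (candidateDepth I.rows)) = true ↔ HiddenAN I := by
  rw [searchCandidates, Bool.and_eq_true, decide_eq_true_eq, candidateDepth, length_candidates_rows,
    List.any_eq_true]
  by_cases hm : I.solCandidates ≤ I.election.numCandidates
  · rw [reqCandidates_eq hm]
    simp only [hm, decide_true, cond_true, true_and, mem_tuples]
    -- Without voters sorting is vacuous and does not exclude repeated candidates, so this case is
    -- settled by the number of candidates.
    rcases Nat.eq_zero_or_pos ((I.solVoters + 1) / 2) with h0 | h0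
    · refine iff_of_true ?_ ((hiddenAN_iff_of_eq_zero h0).mpr hm)
      refine ⟨((List.finRange _).take I.solCandidates).map Fin.val, ⟨by simp [hm], fun i hi => ?_⟩,
        supports_iff.mpr ⟨∅, ∅, by simp [Election.Sorts], by simp, by simp [h0], by simp [h0]⟩⟩
      obtain ⟨j, -, rfl⟩ := List.mem_map.mp hi
      exact j.2
    · rw [hiddenAN_iff_sorts h0]
      constructor
      · rintro ⟨s, ⟨hl, hs⟩, hsup⟩
        lift s to List (Fin I.election.numCandidates) using hs
        obtain ⟨V₁, V₂, h, h'⟩ := supports_iff.mp hsup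
        exact ⟨s, V₁, V₂, h, by simpa using hl, h'⟩
      · rintro ⟨s, V₁, V₂, h, hl, h'⟩
        refine ⟨s.map Fin.val, ⟨by simpa using hl, fun i hi => ?_⟩, supports_iff.mpr ⟨V₁, V₂, h, h'⟩⟩
        obtain ⟨j, -, rfl⟩ := List.mem_map.mp hi
        exact j.2
  · refine iff_of_false (fun h => hm ((reqCandidates_le_iff I).mp h.1)) fun h => hm ?_
    obtain ⟨C, -, -, -, hC, -⟩ := (hiddenAN_iff I).mp h
    rw [← hC]
    simpa using Finset.card_le_univ C

theorem pick_rows (l : List (Fin I.election.numVoters)) :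
    pick I.rows.tail (l.map Fin.val) = l.map I.election.voteList := by
  have h : ∀ (L : List (List ℕ)) i, List.tail^[i] L = L.drop i := by
    intro L i
    induction i with
    | zero => rfl
    | succ i ih => rw [iterate_succ_apply', ih, List.tail_drop]
  rw [pick, List.map_map]
  refine List.map_congr_left fun v _ => ?_
  rw [comp_apply, h, List.headD_eq_head?_getD, List.head?_drop, tail_rows]
  simp

theorem opposed_iff {s t : List (Fin I.election.numVoters)} {c d : Fin I.election.numCandidates} :
    opposed (s.map I.election.voteList) (t.map I.election.voteList) c d = true ↔
      (∀ v ∈ s, I.election.Prefers v c d) ∧ ∀ v ∈ t, I.election.Prefers v d c := by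
  have h : ∀ v, ∀ a b : Fin I.election.numCandidates,
      isSub [(a : ℕ), b] (I.election.voteList v) = true ↔ I.election.Prefers v a b := by
    intro v a b
    simpa using Election.isSub_voteList (v := v) (s := [a, b])
  simp only [opposed, Bool.and_eq_true, List.all_eq_true, List.mem_map, forall_exists_index,
    and_imp, forall_apply_eq_imp_iff₂, h]

/-- `opposed` is transitive, so a chain of neighbours is sorted pairwise. The reversal appears
because chains are listed from their end. -/
theorem hasChain_rows_iff {s t : List (Fin I.election.numVoters)} {k : ℕ} :
    hasChain ((pick I.rows.tail (s.map Fin.val), pick I.rows.tail (t.map Fin.val)),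
      candidates I.rows) k = true ↔
    ∃ l, I.election.Sorts l s.toFinset t.toFinset ∧ l.length = k := by
  rw [hasChain_iff]
  simp only [pick_rows, candidates_rows, List.mem_range]
  have key : ∀ l : List (Fin I.election.numCandidates),
      ((l.map Fin.val).IsChain fun a b => opposed (s.map I.election.voteList)
        (t.map I.election.voteList) b a = true) ↔
      I.election.Sorts l.reverse s.toFinset t.toFinset := by
    intro l
    rw [List.isChain_map]
    simp only [opposed_iff]
    let r : Fin I.election.numCandidates → Fin I.election.numCandidates → Prop := fun a b =>
      (∀ v ∈ s, I.election.Prefers v b a) ∧ ∀ v ∈ t, I.election.Prefers v a b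
    let _ : Trans r r r := ⟨fun h h' =>
      ⟨fun v hv => Election.prefers_trans (h'.1 v hv) (h.1 v hv),
        fun v hv => Election.prefers_trans (h.2 v hv) (h'.2 v hv)⟩⟩
    change l.IsChain r ↔ _
    rw [List.isChain_iff_pairwise]
    simp only [Election.Sorts, List.mem_toFinset, List.pairwise_reverse]
    constructor
    · exact fun h => ⟨fun v hv => h.imp fun h => h.1 v hv, fun v hv => h.imp fun h => h.2 v hv⟩
    · rintro ⟨h, h'⟩
      rw [List.pairwise_iff_getElem]
      simp only [List.pairwise_iff_getElem] at h h'
      exact fun i j hi hj hij => ⟨fun v hv => h v hv i j hi hj hij,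
        fun v hv => h' v hv i j hi hj hij⟩
  constructor
  · rintro ⟨l, hl, hlt, hc⟩
    lift l to List (Fin I.election.numCandidates) using hlt
    exact ⟨l.reverse, (key l).mp hc, by simpa using hl⟩
  · rintro ⟨l, h, hl⟩
    refine ⟨l.reverse.map Fin.val, by simpa using hl, fun i hi => ?_, (key _).mpr (by simpa)⟩
    obtain ⟨j, -, rfl⟩ := List.mem_map.mp hi
    exact j.2

theorem searchVoters_iff : searchVoters I.rows
    (tuples I.rows.tail.length (voterDepth I.rows)) = true ↔ HiddenAN I := by
  rw [searchVoters, Bool.and_eq_true, Bool.and_eq_true, decide_eq_true_eq, decide_eq_true_eq,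
    voterDepth, length_candidates_rows, length_tail_rows]
  by_cases hn : (I.solVoters + 1) / 2 + (I.solVoters + 1) / 2 ≤ I.election.numVoters
  swap
  · refine iff_of_false (fun h => hn ((add_halfVoters_le_iff le_rfl).mp h.1)) fun h => hn ?_
    obtain ⟨C, V₁, V₂, -, -, hd, h₁, h₂⟩ := (hiddenAN_iff I).mp h
    have := Finset.card_le_univ (V₁ ∪ V₂)
    rw [Finset.card_union_of_disjoint hd, Fintype.card_fin] at this
    omega
  by_cases hm : I.solCandidates ≤ I.election.numCandidates
  swap
  · refine iff_of_false (fun h => hm ((reqCandidates_le_iff I).mp h.2.1)) fun h => hm ?_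
    obtain ⟨C, -, -, -, hC, -⟩ := (hiddenAN_iff I).mp h
    rw [← hC]
    simpa using Finset.card_le_univ C
  rw [reqCandidates_eq hm, halfVoters_eq hn]
  simp only [hn, hm, decide_true, cond_true, true_and, List.any_eq_true, mem_tuples,
    Bool.and_eq_true, nodupTest_iff]
  -- With two empty tuples `opposed` always holds, so any list of `m'` candidates is a chain.
  rcases Nat.eq_zero_or_pos ((I.solVoters + 1) / 2) with h0 | h0
  · refine iff_of_true ⟨[], by simp [h0], [], by simp [h0], by simp, ?_⟩
      ((hiddenAN_iff_of_eq_zero h0).mpr hm)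
    rw [hasChain_iff]
    refine ⟨List.range I.solCandidates, by simp, fun i hi => ?_, ?_⟩
    · rw [candidates_rows]
      simp only [List.mem_range] at hi ⊢
      omega
    · simp [opposed, pick, List.isChain_iff_getElem]
  · rw [hiddenAN_iff_sorts h0]
    constructor
    · rintro ⟨s, ⟨hs, hs'⟩, t, ⟨ht, ht'⟩, hnd, hc⟩
      lift s to List (Fin I.election.numVoters) using hs'
      lift t to List (Fin I.election.numVoters) using ht'
      -- Absence of repetitions in `s ++ t` yields both the sizes of the two sides and their
      -- disjointness.
      rw [← List.map_append] at hnd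
      obtain ⟨hnd1, hnd2, hd⟩ := List.nodup_append.mp (List.Nodup.of_map _ hnd)
      rw [List.length_map] at hs ht
      obtain ⟨l, hl, hl'⟩ := hasChain_rows_iff.mp hc
      refine ⟨l, s.toFinset, t.toFinset, hl, hl', ?_, ?_, ?_⟩
      · rw [Finset.disjoint_left]
        exact fun v h h' => hd v (List.mem_toFinset.mp h) v (List.mem_toFinset.mp h') rfl
      · rw [List.toFinset_card_of_nodup hnd1, hs]
      · rw [List.toFinset_card_of_nodup hnd2, ht]
    · rintro ⟨l, V₁, V₂, hl, hl', hd, h₁, h₂⟩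
      have hlt : ∀ V : Finset (Fin I.election.numVoters), ∀ i ∈ V.toList.map Fin.val,
          i < I.election.numVoters := by
        intro V i hi
        obtain ⟨j, -, rfl⟩ := List.mem_map.mp hi
        exact j.2
      refine ⟨V₁.toList.map Fin.val, ⟨by simp [h₁], hlt _⟩, V₂.toList.map Fin.val,
        ⟨by simp [h₂], hlt _⟩, ?_, ?_⟩
      · rw [← List.map_append]
        refine List.Nodup.map Fin.val_injective (List.nodup_append.mpr
          ⟨V₁.nodup_toList, V₂.nodup_toList, fun a ha b hb e => ?_⟩)
        subst e
        exact Finset.disjoint_left.mp hd (Finset.mem_toList.mp ha) (Finset.mem_toList.mp hb)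
      · rw [hasChain_rows_iff]
        exact ⟨l, by simpa using hl, hl'⟩

end

/-! ### The complexity of the problem -/

theorem computable_bound (c : ℕ) : Computable fun k : ℕ => (k ^ k + 3) ^ c := by
  have hpow : Primrec₂ fun a b : ℕ => a ^ b := Primrec₂.unpaired'.mp Nat.Primrec.pow
  exact (hpow.comp (Primrec.nat_add.comp (hpow.comp .id .id) (.const 3)) (.const c)).to_comp

theorem computable_exponent (c : ℕ) : Computable fun k : ℕ => (k + 1) * c :=
  (Primrec.nat_mul.comp (Primrec.nat_add.comp .id (.const 1)) (.const c)).to_comp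

/-- A problem decided by a search through the tuples of length `depth` with entries below `κ`, in
time polynomial in their number and the length of the input, is in FPT. -/
theorem isFPT_of_search {p : Instance → Prop} {κ depth : Instance → ℕ} {c : ℕ}
    (h : DecidableInTime Instance.encode p fun I => (I.encode.length + κ I ^ depth I + 2) ^ c)
    (hd : ∀ I, depth I ≤ κ I) : IsFPT Instance.encode p κ := by
  refine ⟨fun k => (k ^ k + 3) ^ c, c, computable_bound c, h.mono fun I => ?_⟩
  rw [← mul_pow]
  refine Nat.pow_le_pow_left ?_ c
  have h1 : κ I ^ depth I ≤ κ I ^ κ I := by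
    -- Monotonicity in the exponent needs a positive base; if `κ I = 0`, the depth is 0 too and both
    -- powers are 1.
    rcases Nat.eq_zero_or_pos (κ I) with h0 | h0
    · have := hd I
      rw [h0] at this ⊢
      rw [Nat.le_zero.mp this]
    · exact Nat.pow_le_pow_right h0 (hd I)
  have h2 := length_encode_pos I
  -- Since `1 ≤ |x|`, the sum `|x| + κ ^ κ + 2` is at most `(κ ^ κ + 3) * |x|`.
  nlinarith [Nat.zero_le (κ I ^ κ I)]

/-- A problem decided by a search through the tuples of length `depth` with at most `|x|` entries,
in time polynomial in their number and the length of the input, is in XP. -/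
theorem isXP_of_search {p : Instance → Prop} {n depth κ : Instance → ℕ} {c : ℕ}
    (h : DecidableInTime Instance.encode p fun I => (I.encode.length + n I ^ depth I + 2) ^ c)
    (hn : ∀ I, n I ≤ I.encode.length) (hd : ∀ I, depth I ≤ κ I) :
    IsXP Instance.encode p κ := by
  refine ⟨fun _ => 4 ^ c, fun k => (k + 1) * c, .const _, computable_exponent c,
    h.mono fun I => ?_⟩
  rw [pow_mul, ← mul_pow]
  -- Each of `|x|`, `|x| ^ κ`, 1 and 1 is at most `|x| ^ (κ + 1)`, whence the factor 4.
  refine Nat.pow_le_pow_left ?_ c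
  have h1 : n I ^ depth I ≤ I.encode.length ^ κ I :=
    (Nat.pow_le_pow_left (hn I) _).trans (Nat.pow_le_pow_right (length_encode_pos I) (hd I))
  have h2 := length_encode_pos I
  have h3 : 1 ≤ I.encode.length ^ κ I := Nat.one_le_pow _ _ h2
  rw [pow_succ]
  nlinarith

theorem sized_of_length_le {μ : Instance → ℕ} (h : ∀ I : Instance, I.encode.length ≤ μ I) :
    Sized μ :=
  ⟨(((PolyBound.const 8).mul (.refl μ)).add (.const 1)).mono fun I =>
    (esize_instance_le I).trans (by have := h I; omega)⟩

theorem Bdd.of_polyTime {α β : Type} [Enc α] [Enc β] {μ : α → ℕ} [Sized μ] {f : α → β}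
    (hf : PolyTime f) : Bdd μ f := PolyTime.comp hf .id

theorem decidable_searchCandidates : ∃ c, DecidableInTime Instance.encode HiddenAN fun I =>
    (I.encode.length + I.election.numCandidates ^ candidateDepth I.rows + 2) ^ c := by
  have hμ : ∀ I : Instance, I.encode.length ≤
      I.encode.length + I.election.numCandidates ^ candidateDepth I.rows :=
    fun I => Nat.le_add_right _ _
  have := sized_of_length_le hμ
  have hR := Bdd.of_polyTime (μ := fun I : Instance =>
    I.encode.length + I.election.numCandidates ^ candidateDepth I.rows) polyTime_rows
  refine Bdd.decidableInTime hμ (hR.searchCandidates (hR.candidates.length.tuples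
    hR.candidateDepth ?_)) fun I => searchCandidates_iff
  exact (PolyBound.refl _).mono fun I => by
    rw [length_candidates_rows]
    exact Nat.le_add_left _ _

theorem decidable_searchVoters : ∃ c, DecidableInTime Instance.encode HiddenAN fun I =>
    (I.encode.length + I.election.numVoters ^ voterDepth I.rows + 2) ^ c := by
  have hμ : ∀ I : Instance, I.encode.length ≤
      I.encode.length + I.election.numVoters ^ voterDepth I.rows :=
    fun I => Nat.le_add_right _ _
  have := sized_of_length_le hμ
  have hR := Bdd.of_polyTime (μ := fun I : Instance =>
    I.encode.length + I.election.numVoters ^ voterDepth I.rows) polyTime_rows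
  refine Bdd.decidableInTime hμ (hR.searchVoters (hR.tail.length.tuples hR.voterDepth ?_))
    fun I => searchVoters_iff
  exact (PolyBound.refl _).mono fun I => by
    rw [length_tail_rows]
    exact Nat.le_add_left _ _

/-- Setting the depth to 0 on instances with `m' > |C|` yields the bound by `|C|`; this serves FPT,
the bound by `m'` serves XP. -/
theorem candidateDepth_le (I : Instance) :
    candidateDepth I.rows ≤ I.election.numCandidates ∧ candidateDepth I.rows ≤ I.solCandidates := by
  have h := reqCandidates_rows I
  rw [candidateDepth, length_candidates_rows]
  by_cases hr : reqCandidates I.rows ≤ I.election.numCandidates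
  · simp only [hr, decide_true, cond_true, true_and]
    omega
  · simp [hr]

theorem voterDepth_le (I : Instance) :
    voterDepth I.rows ≤ I.election.numVoters ∧ voterDepth I.rows ≤ I.solVoters := by
  have h := halfVoters_rows I
  rw [voterDepth, length_tail_rows]
  by_cases hr : halfVoters I.rows + halfVoters I.rows ≤ I.election.numVoters
  · simp only [hr, decide_true, cond_true]
    omega
  · simp [hr]

end HiddenSubelections

theorem mainTheorem10 :
    HiddenSubelections.IsFPT HiddenSubelections.Instance.encode HiddenSubelections.HiddenAN
        (fun I => I.election.numVoters) ∧
      HiddenSubelections.IsFPT HiddenSubelections.Instance.encode HiddenSubelections.HiddenAN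
        (fun I => I.election.numCandidates) ∧
      HiddenSubelections.IsXP HiddenSubelections.Instance.encode HiddenSubelections.HiddenAN
        (fun I => I.solVoters) ∧
      HiddenSubelections.IsXP HiddenSubelections.Instance.encode HiddenSubelections.HiddenAN
        (fun I => I.solCandidates) := by
  obtain ⟨_, hC⟩ := HiddenSubelections.decidable_searchCandidates
  obtain ⟨_, hV⟩ := HiddenSubelections.decidable_searchVoters
  exact ⟨HiddenSubelections.isFPT_of_search hV fun I => (HiddenSubelections.voterDepth_le I).1,
    HiddenSubelections.isFPT_of_search hC fun I => (HiddenSubelections.candidateDepth_le I).1,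
    HiddenSubelections.isXP_of_search hV (fun I => (HiddenSubelections.numVoters_lt I).le)
      fun I => (HiddenSubelections.voterDepth_le I).2,
    HiddenSubelections.isXP_of_search hC (fun I => (HiddenSubelections.numCandidates_lt I).le)
      fun I => (HiddenSubelections.candidateDepth_le I).2⟩
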